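/- Let $H$ be a separable real Hilbert space and let $X$ be an $H$-valued random variable such that (A1) for every $h\in H$ there is $h'\in H$ with $\langle h,h'\rangle=0$ and $\operatorname{Var}(\langle X,h'\rangle)>0$ (variance in $[0,\infty]$); (A2) there is a constant $C>0$ such that, for every $h\in H$, $\mathbb E\left[\frac1{\|X-h\|}\right]\le C$ and $\mathbb E\left[\frac1{\|X-h\|^2}\right]\le C$ (with $1/0=\infty$). Let $m$ be the geometric median of $X$, that is, the minimizer over $h\in H$ of $\mathbb E\left[\|X-h\|-\|X\|\right]$. Let $X_1,X_2,\dots$ be independent random variables with the law of $X$, let $Z_1$ be an almost surely bounded $H$-valued random variable independent of $(X_n)_{n\ge2}$ (for example deterministic, or a bounded measurable function of $X_1$), let $\gamma_n=c_\gamma n^{-\alpha}$ with $c_\gamma>0$ and $\alpha\in(1/2,1)$, and for $n\ge1$ put $$Z_{n+1}=Z_n+\gamma_n\frac{X_{n+1}-Z_n}{\|X_{n+1}-Z_n\|},\qquad \overline Z_{n+1}=\overline Z_n-\frac1{n+1}\left(\overline Z_n-Z_{n+1}\right),\qquad \overline Z_1=Z_1,$$ with the convention that the fraction in the first recursion is $0$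 when $X_{n+1}=Z_n$ (an event of probability zero). Then, for every $\delta>0$, $$\left\|\overline Z_n-m\right\|=o\left(\frac{(\ln n)^{\frac{1+\delta}2}}{\sqrt n}\right)\quad\text{as } n\to\infty,\ \text{almost surely.}$$ -/

import Mathlib

open MeasureTheory ProbabilityTheory Filter Asymptotics
open scoped ENNReal Topology

section GeometricMedian

variable {Ω H : Type*} [MeasurableSpace Ω] [NormedAddCommGroup H] [InnerProductSpace ℝ H]

/-- The objective `G(h) = 𝔼[‖X - h‖ - ‖X‖]`. The integrand is bounded by `‖h‖`, so no moment
assumption on `X` is needed for the expectation to make sense. -/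
noncomputable def medianObjective (P : Measure Ω) (X : Ω → H) (h : H) : ℝ :=
  ∫ ω, (‖X ω - h‖ - ‖X ω‖) ∂P

/-- `m` is a geometric median of `X`: a minimizer of `h ↦ 𝔼[‖X - h‖ - ‖X‖]` over the whole space. -/
def IsGeometricMedian (P : Measure Ω) (X : Ω → H) (m : H) : Prop :=
  ∀ h : H, medianObjective P X m ≤ medianObjective P X h

/-- `X` is not concentrated on a straight line: every `h` has an orthogonal `h'` such that
`Var ⟨X, h'⟩ > 0`. The variance takes values in `[0, ∞]`, since `X` need not have any moment; it is
`∞` when `⟨X, h'⟩` is not square integrable. -/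
def NotConcentratedOnLine (P : Measure Ω) (X : Ω → H) : Prop :=
  ∀ h : H, ∃ h' : H, inner ℝ h h' = 0 ∧ 0 < evariance (fun ω => inner ℝ (X ω) h') P

/-- `X` is not concentrated around single points: `𝔼[1/‖X - h‖]` and `𝔼[1/‖X - h‖²]` are bounded
uniformly in `h`. The expectations take values in `[0, ∞]` and `1/0 = ∞`. -/
def NotConcentratedAroundPoints (P : Measure Ω) (X : Ω → H) : Prop :=
  ∃ C : ℝ, 0 < C ∧ ∀ h : H,
    ∫⁻ ω, ‖X ω - h‖ₑ⁻¹ ∂P ≤ ENNReal.ofReal C ∧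
    ∫⁻ ω, (‖X ω - h‖ₑ ^ 2)⁻¹ ∂P ≤ ENNReal.ofReal C

end GeometricMedian

section Algorithms

variable {Ω H : Type*} [NormedAddCommGroup H] [InnerProductSpace ℝ H]

/-- The step sequence `γ_n = c n^{-α}` (used for `n ≥ 1`). -/
noncomputable def stepSize (c α : ℝ) (n : ℕ) : ℝ := c * (n : ℝ) ^ (-α)

/-- The stochastic gradient iterates `Z_1 = Z₁`,
`Z_{n+1} = Z_n + γ_n (X_{n+1} - Z_n) / ‖X_{n+1} - Z_n‖` for `n ≥ 1`.
The time index starts at `1`; the value at index `0` is a dummy that nothing depends on. -/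
noncomputable def sgdIterate (γ : ℕ → ℝ) (X : ℕ → Ω → H) (Z₁ : Ω → H) : ℕ → Ω → H
  | 0 => Z₁
  | 1 => Z₁
  | n + 2 => fun ω =>
      sgdIterate γ X Z₁ (n + 1) ω +
        γ (n + 1) • (‖X (n + 2) ω - sgdIterate γ X Z₁ (n + 1) ω‖⁻¹ •
          (X (n + 2) ω - sgdIterate γ X Z₁ (n + 1) ω))

/-- The averaged version `Z̄_1 = Z_1`, `Z̄_{n+1} = Z̄_n - (Z̄_n - Z_{n+1}) / (n + 1)` for `n ≥ 1` of a
sequence `Z` indexed from `1`; the value at index `0` is a dummy. -/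
noncomputable def averagedIterate (Z : ℕ → Ω → H) : ℕ → Ω → H
  | 0 => Z 1
  | 1 => Z 1
  | n + 2 => fun ω =>
      averagedIterate Z (n + 1) ω -
        ((n : ℝ) + 2)⁻¹ • (averagedIterate Z (n + 1) ω - Z (n + 2) ω)

/-- The averaged sequence is the arithmetic mean of `Z_1, …, Z_n`. -/
theorem averagedIterate_eq_mean (Z : ℕ → Ω → H) (n : ℕ) (hn : 1 ≤ n) (ω : Ω) :
    averagedIterate Z n ω = (n : ℝ)⁻¹ • ∑ k ∈ Finset.Icc 1 n, Z k ω := by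
  induction n, hn using Nat.le_induction with
  | base => simp [averagedIterate]
  | succ n hn ih =>
    obtain ⟨k, rfl⟩ : ∃ k, n = k + 1 := ⟨n - 1, by omega⟩
    rw [Finset.sum_Icc_succ_top (by omega), averagedIterate]
    beta_reduce
    rw [ih]
    have h1 : (k : ℝ) + 1 ≠ 0 := by positivity
    have h2 : (k : ℝ) + 2 ≠ 0 := by positivity
    have h3 : (k : ℝ) + 1 + 1 ≠ 0 := by positivity
    push_cast
    match_scalars <;> field_simp <;> ring

end Algorithms

/-! ### The norm: gradient, Hessian and second order expansion -/

section UnitDirection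

variable {H : Type*} [NormedAddCommGroup H] [InnerProductSpace ℝ H]

/-! Write `Φ = medianGrad μ`, `Γ = medianHess μ m`, `V k = z k - m`, and let `D k` be the random
direction used at step `k`, so that `V (k + 1) = V k - γ k • D k`. Minimality of `m` gives `Φ m =
0`. The proof rests on the decomposition `Γ (V k) = (Φ (z k) - D k) + D k - (Φ (z k) - Γ (V k))`,
summed over `k < n`. The first terms form a martingale with bounded increments; the second, `D k =
(γ k)⁻¹ • (V k - V (k + 1))`, is handled by Abel summation; the third is quadratic in `V k` because
`𝔼[1/‖X - m‖²]` is finite. Almost surely all three sums are `O(√(b n))` with `b n = (n + 2) log (n +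
2) ^ s`, `s = 1 + δ / 2`. Coercivity of `Γ` transfers this bound to `∑ V k` (`exists_norm_sum_le`),
and dividing by `n` gives the rate.

The probabilistic input comes from Robbins–Siegmund arguments that need `∑ 1 / b n < ∞`. They bound
the martingale (`ae_norm_gradNoise_sq_le`) and yield `‖V n‖² = O(γ n ^ 2 * b n)` together with `∑ ‖V
n‖² / (γ n * b n) < ∞` (`ae_rate`). The former controls the Abel terms; the latter, with `γ n * √(b
n)` bounded because `α > 1/2`, controls the quadratic remainder. The condition `α < 1` makes the
drift, of order `γ n`, dominate the relative variation `1 / n` of the steps.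

The geometric input is a spectral gap for `Γ` (`exists_medianHess_coercive`), proved by averaging
since the unit sphere of `H` need not be compact. Monotonicity of `Φ` spreads it to strong
monotonicity on every ball around `m`. -/

/-- The direction `y / ‖y‖` of a vector, with value `0` at `0`: the gradient of the norm. -/
noncomputable def unitDir (y : H) : H := ‖y‖⁻¹ • y

/-- The second derivative `‖y‖⁻¹ (k - ⟨u, k⟩ u)`, `u = y / ‖y‖`, of the norm at `y`, applied to `k`. -/
noncomputable def normHess (y k : H) : H :=
  ‖y‖⁻¹ • (k - inner ℝ (unitDir y) k • unitDir y)

@[simp] theorem unitDir_zero : unitDir (0 : H) = 0 := by simp [unitDir]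

theorem unitDir_neg (y : H) : unitDir (-y) = -unitDir y := by simp [unitDir]

theorem norm_unitDir {y : H} (hy : y ≠ 0) : ‖unitDir y‖ = 1 := by
  rw [unitDir, norm_smul, norm_inv, norm_norm, inv_mul_cancel₀ (norm_ne_zero_iff.2 hy)]

theorem norm_unitDir_le (y : H) : ‖unitDir y‖ ≤ 1 := by
  rcases eq_or_ne y 0 with rfl | hy
  · simp
  · exact (norm_unitDir hy).le

theorem norm_smul_unitDir (y : H) : ‖y‖ • unitDir y = y := by
  rcases eq_or_ne y 0 with rfl | hy
  · simp
  · rw [unitDir, smul_inv_smul₀ (norm_ne_zero_iff.2 hy)]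

theorem inner_unitDir_self (y : H) : inner ℝ (unitDir y) y = ‖y‖ := by
  rcases eq_or_ne y 0 with rfl | hy
  · simp
  · have := norm_ne_zero_iff.2 hy
    rw [unitDir, real_inner_smul_left, real_inner_self_eq_norm_sq]
    field_simp

theorem abs_inner_unitDir_le (y k : H) : |inner ℝ (unitDir y) k| ≤ ‖k‖ :=
  (abs_real_inner_le_norm _ _).trans (by
    nlinarith [norm_unitDir_le y, norm_nonneg k, norm_nonneg (unitDir y)])

/-- `unitDir y` is a subgradient of the norm at `y`. -/
theorem norm_add_inner_unitDir_le (y k : H) : ‖y‖ + inner ℝ (unitDir y) k ≤ ‖y + k‖ := by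
  rw [← inner_unitDir_self y, ← inner_add_right]
  exact (le_abs_self _).trans (abs_inner_unitDir_le _ _)

/-- Subgradients of a convex function are monotone: add the subgradient inequalities at `a` and at
`b`. -/
theorem inner_unitDir_sub_nonneg (a b : H) :
    0 ≤ inner ℝ (unitDir a - unitDir b) (a - b) := by
  have h1 := norm_add_inner_unitDir_le a (b - a)
  have h2 := norm_add_inner_unitDir_le b (a - b)
  rw [add_sub_cancel] at h1 h2
  have h3 : inner ℝ (unitDir a) (b - a) = -inner ℝ (unitDir a) (a - b) := by
    rw [← inner_neg_right, neg_sub]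
  rw [inner_sub_left]
  linarith

theorem inner_normHess_self (y k : H) :
    inner ℝ (normHess y k) k = ‖y‖⁻¹ * (‖k‖ ^ 2 - inner ℝ (unitDir y) k ^ 2) := by
  rw [normHess, real_inner_smul_left, inner_sub_left, real_inner_smul_left,
    real_inner_self_eq_norm_sq]
  ring

theorem inner_normHess_self_nonneg (y k : H) : 0 ≤ inner ℝ (normHess y k) k := by
  rw [inner_normHess_self]
  have := sq_le_sq' (neg_le_of_abs_le (abs_inner_unitDir_le y k))
    (le_of_abs_le (abs_inner_unitDir_le y k))
  have h0 := inv_nonneg.2 (norm_nonneg y)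
  exact mul_nonneg h0 (by linarith)

theorem norm_normHess_le (y k : H) : ‖normHess y k‖ ≤ 2 * ‖y‖⁻¹ * ‖k‖ := by
  rw [normHess, norm_smul, norm_inv, norm_norm]
  have h : ‖k - inner ℝ (unitDir y) k • unitDir y‖ ≤ 2 * ‖k‖ := by
    refine (norm_sub_le _ _).trans ?_
    rw [norm_smul, Real.norm_eq_abs]
    nlinarith [abs_inner_unitDir_le y k, norm_unitDir_le y, norm_nonneg (unitDir y),
      abs_nonneg (inner ℝ (unitDir y) k)]
  calc ‖y‖⁻¹ * ‖k - inner ℝ (unitDir y) k • unitDir y‖ ≤ ‖y‖⁻¹ * (2 * ‖k‖) := by gcongr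
    _ = _ := by ring

theorem normHess_sum {ι : Type*} (s : Finset ι) (y : H) (f : ι → H) :
    normHess y (∑ i ∈ s, f i) = ∑ i ∈ s, normHess y (f i) := by
  simp only [normHess, inner_sum, Finset.sum_smul, ← Finset.smul_sum, Finset.sum_sub_distrib]

/-- Second order expansion of the direction, with a remainder bound for all increments. -/
theorem norm_unitDir_add_sub_le {y : H} (hy : y ≠ 0) (k : H) :
    ‖unitDir (y + k) - unitDir y - normHess y k‖ ≤ 3 * (‖y‖⁻¹ ^ 2 * ‖k‖ ^ 2) := by
  have ha : 0 < ‖y‖ := norm_pos_iff.2 hy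
  -- The singular case `k = -y`: the Hessian term vanishes, since `k` is radial, and the left side
  -- is `1`.
  rcases eq_or_ne (y + k) 0 with hb | hb
  · have hk : k = -y := by rw [← add_eq_zero_iff_eq_neg'.1 hb]
    have h0 : normHess y k = 0 := by
      rw [normHess, hk, inner_neg_right, inner_unitDir_self, neg_smul, norm_smul_unitDir]
      simp
    rw [h0, hb, hk, norm_neg, unitDir_zero, zero_sub, sub_zero, norm_neg, norm_unitDir hy,
      ← mul_pow, inv_mul_cancel₀ ha.ne']
    norm_num
  set u := unitDir y with hu
  set v := unitDir (y + k) with hv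
  set a := ‖y‖
  set b := ‖y + k‖
  set t := inner ℝ u k
  have hau : a • u = y := norm_smul_unitDir y
  have hbv : b • v = y + k := norm_smul_unitDir (y + k)
  have hv1 : ‖v‖ = 1 := norm_unitDir hb
  have hu1 : ‖u‖ = 1 := norm_unitDir hy
  -- An exact identity whose two terms are each of second order: `|a - b| ≤ ‖k‖` with `‖v - u‖ ≤
  -- 2‖k‖/a`, and `|a + t - b| ≤ ‖k‖²/a`. Hence the constant `2 + 1 = 3`.
  have key : v - u - normHess y k = a⁻¹ • ((a - b) • (v - u) + (a + t - b) • u) := by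
    have hk : k = b • v - a • u := by rw [hau, hbv]; abel
    have : normHess y k = a⁻¹ • (k - t • u) := rfl
    rw [this, hk]
    match_scalars <;> field_simp <;> ring
  have hab : |a - b| ≤ ‖k‖ := by
    have := abs_norm_sub_norm_le y (y + k)
    rwa [sub_add_cancel_left, norm_neg] at this
  have hvu : ‖v - u‖ ≤ 2 * ‖k‖ / a := by
    rw [le_div_iff₀ ha]
    have : a • (v - u) = (a - b) • v + k := by
      rw [smul_sub, hau, sub_smul, hbv]; abel
    have h2 : ‖v - u‖ * a = ‖a • (v - u)‖ := by
      rw [norm_smul, Real.norm_of_nonneg ha.le, mul_comm]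
    rw [h2, this]
    refine (norm_add_le _ _).trans ?_
    rw [norm_smul, hv1, Real.norm_eq_abs]
    linarith
  have ht : |t| ≤ ‖k‖ := abs_inner_unitDir_le y k
  have h1 : a + t ≤ b := norm_add_inner_unitDir_le y k
  have h2 : b ≤ a + t + ‖k‖ ^ 2 / a := by
    have hb2 : b ^ 2 = a ^ 2 + 2 * (a * t) + ‖k‖ ^ 2 := by
      have : inner ℝ y k = a * t := by rw [← hau, real_inner_smul_left]
      rw [← this]
      exact norm_add_sq_real y k
    have hκ : ‖k‖ ^ 2 / a * a = ‖k‖ ^ 2 := by field_simp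
    refine abs_le_of_sq_le_sq' ?_ ?_ |>.2
    · nlinarith [sq_nonneg (t + ‖k‖ ^ 2 / a), sq_nonneg ‖k‖]
    · have : 0 ≤ (a + t + ‖k‖ ^ 2 / a) * a := by
        nlinarith [sq_nonneg (a - ‖k‖), neg_le_of_abs_le ht, norm_nonneg k]
      exact nonneg_of_mul_nonneg_left this ha
  have h3 : |a + t - b| ≤ ‖k‖ ^ 2 / a := by
    rw [abs_le]; constructor <;> linarith
  rw [key, norm_smul, norm_inv, Real.norm_of_nonneg ha.le]
  have h4 : ‖(a - b) • (v - u) + (a + t - b) • u‖ ≤ ‖k‖ * (2 * ‖k‖ / a) + ‖k‖ ^ 2 / a := by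
    refine (norm_add_le _ _).trans ?_
    rw [norm_smul, norm_smul, hu1, mul_one, Real.norm_eq_abs, Real.norm_eq_abs]
    gcongr
  calc a⁻¹ * ‖(a - b) • (v - u) + (a + t - b) • u‖
      ≤ a⁻¹ * (‖k‖ * (2 * ‖k‖ / a) + ‖k‖ ^ 2 / a) := by gcongr
    _ = 3 * (a⁻¹ ^ 2 * ‖k‖ ^ 2) := by field_simp; ring

/-- For unit vectors, `√(1 - ⟨u, v⟩²)` is a metric on lines up to a constant. -/
theorem one_sub_inner_sq_le {u v k : H} (hu : ‖u‖ = 1) (hv : ‖v‖ = 1) (hk : ‖k‖ = 1) :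
    1 - inner ℝ u v ^ 2 ≤ 2 * (1 - inner ℝ u k ^ 2) + 2 * (1 - inner ℝ v k ^ 2) := by
  set a : ℝ := inner ℝ u k
  set b : ℝ := inner ℝ v k
  set c : ℝ := inner ℝ u v
  have hc : |c| ≤ 1 := by simpa [hu, hv] using abs_real_inner_le_norm u v
  -- Cauchy–Schwarz for `a u + b v` against `k` leads to `a² + b² ≤ 1 + |c|`, the top eigenvalue of
  -- the Gram matrix of `u, v`. Then `1 - c² ≤ 2(1 - |c|)` concludes.
  have h1 : inner ℝ (a • u + b • v) k = a ^ 2 + b ^ 2 := by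
    rw [inner_add_left, real_inner_smul_left, real_inner_smul_left]
    ring
  have h2 : ‖a • u + b • v‖ ^ 2 = a ^ 2 + b ^ 2 + 2 * (a * b * c) := by
    rw [norm_add_sq_real, norm_smul, norm_smul, real_inner_smul_left, real_inner_smul_right, hu, hv,
      mul_one, mul_one, Real.norm_eq_abs, Real.norm_eq_abs, sq_abs, sq_abs]
    ring
  have h3 := abs_real_inner_le_norm (a • u + b • v) k
  rw [hk, mul_one, h1] at h3
  have h4 : (a ^ 2 + b ^ 2) ^ 2 ≤ a ^ 2 + b ^ 2 + 2 * (a * b * c) :=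
    h2 ▸ sq_le_sq' (neg_le_of_abs_le h3) (le_of_abs_le h3)
  have h5 : 2 * (a * b * c) ≤ (a ^ 2 + b ^ 2) * |c| := by
    have h6 : 2 * |a * b| ≤ a ^ 2 + b ^ 2 := by
      rw [abs_mul]
      nlinarith [sq_nonneg (|a| - |b|), sq_abs a, sq_abs b]
    calc 2 * (a * b * c) ≤ 2 * |a * b * c| := by linarith [le_abs_self (a * b * c)]
      _ = 2 * |a * b| * |c| := by rw [abs_mul (a * b) c]; ring
      _ ≤ _ := by gcongr
  have h7 : a ^ 2 + b ^ 2 ≤ 1 + |c| := by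
    rcases (add_nonneg (sq_nonneg a) (sq_nonneg b)).eq_or_lt with h | h
    · rw [← h]; positivity
    · nlinarith
  nlinarith [sq_nonneg (1 - |c|), sq_abs c]

end UnitDirection

/-! ### Gradient and Hessian of the median objective -/

section MedianGradient

variable {H : Type*} [NormedAddCommGroup H] [InnerProductSpace ℝ H]
  [MeasurableSpace H]

/-- The gradient `h ↦ 𝔼[(h - X) / ‖h - X‖]` of the objective of the geometric median of the law `μ`. -/
noncomputable def medianGrad (μ : Measure H) (h : H) : H := ∫ x, unitDir (h - x) ∂μ

/-- The Hessian at `m` of the objective of the geometric median of the law `μ`, applied to `k`. -/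
noncomputable def medianHess (μ : Measure H) (m k : H) : H := ∫ x, normHess (m - x) k ∂μ

variable [BorelSpace H] [SecondCountableTopology H]

@[fun_prop]
theorem measurable_unitDir : Measurable (unitDir : H → H) := by
  unfold unitDir
  fun_prop

@[fun_prop]
theorem measurable_normHess : Measurable (fun p : H × H => normHess p.1 p.2) := by
  unfold normHess
  fun_prop

variable {μ : Measure H} [IsProbabilityMeasure μ]

theorem integrable_unitDir (h : H) : Integrable (fun x => unitDir (h - x)) μ :=
  Integrable.of_bound (measurable_unitDir.comp (by fun_prop)).aestronglyMeasurable 1 (ae_of_all _ fun _ => norm_unitDir_le _)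

omit [BorelSpace H] [SecondCountableTopology H] in
theorem norm_medianGrad_le (h : H) : ‖medianGrad μ h‖ ≤ 1 := by
  have := norm_integral_le_of_norm_le_const (μ := μ)
    (ae_of_all _ fun x => norm_unitDir_le (h - x))
  simpa [medianGrad] using this

theorem measurable_medianGrad : Measurable (medianGrad μ) := by
  have : StronglyMeasurable (fun p : H × H => unitDir (p.1 - p.2)) :=
    Measurable.stronglyMeasurable (by fun_prop)
  exact (this.integral_prod_right' (ν := μ)).measurable

omit [IsProbabilityMeasure μ] in
theorem integrable_normHess {m : H} (h₁ : Integrable (fun x => ‖m - x‖⁻¹) μ) (k : H) :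
    Integrable (fun x => normHess (m - x) k) μ := by
  refine ((h₁.const_mul 2).mul_const ‖k‖).mono' ?_ (ae_of_all _ fun x => norm_normHess_le _ _)
  have : Measurable (fun x => normHess (m - x) k) :=
    measurable_normHess.comp (f := fun x => (m - x, k)) (by fun_prop)
  exact this.aestronglyMeasurable

omit [IsProbabilityMeasure μ] in
theorem medianHess_sum {ι : Type*} (s : Finset ι) {m : H}
    (h₁ : Integrable (fun x => ‖m - x‖⁻¹) μ) (f : ι → H) :
    medianHess μ m (∑ i ∈ s, f i) = ∑ i ∈ s, medianHess μ m (f i) := by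
  simp only [medianHess, normHess_sum]
  exact integral_finsetSum _ fun i _ => integrable_normHess h₁ (f i)

variable [CompleteSpace H]

theorem inner_medianGrad (h w : H) :
    inner ℝ w (medianGrad μ h) = ∫ x, inner ℝ w (unitDir (h - x)) ∂μ :=
  (integral_inner (integrable_unitDir h) w).symm

theorem inner_medianGrad_sub_nonneg (a b : H) :
    0 ≤ inner ℝ (medianGrad μ a - medianGrad μ b) (a - b) := by
  rw [medianGrad, medianGrad, ← integral_sub (integrable_unitDir a) (integrable_unitDir b),
    real_inner_comm,
    ← integral_inner (f := fun x => unitDir (a - x) - unitDir (b - x))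
      ((integrable_unitDir a).sub (integrable_unitDir b))]
  refine integral_nonneg fun x => ?_
  have := inner_unitDir_sub_nonneg (a - x) (b - x)
  rwa [sub_sub_sub_cancel_right, real_inner_comm] at this

omit [CompleteSpace H] in
-- The pointwise expansion of the direction is valid for every increment, so integrating it costs
-- only the second inverse moment at `m` and restricts `h` in no way.
theorem norm_medianGrad_sub_le {m : H} (h₀ : ∀ᵐ x ∂μ, m - x ≠ 0)
    (h₁ : Integrable (fun x => ‖m - x‖⁻¹) μ) (h₂ : Integrable (fun x => ‖m - x‖⁻¹ ^ 2) μ) (h : H) :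
    ‖medianGrad μ h - medianGrad μ m - medianHess μ m (h - m)‖ ≤
      3 * (∫ x, ‖m - x‖⁻¹ ^ 2 ∂μ) * ‖h - m‖ ^ 2 := by
  rw [medianGrad, medianGrad, medianHess,
    ← integral_sub (integrable_unitDir h) (integrable_unitDir m),
    ← integral_sub (f := fun x => unitDir (h - x) - unitDir (m - x))
      ((integrable_unitDir h).sub (integrable_unitDir m)) (integrable_normHess h₁ _),
    mul_assoc, ← integral_mul_const, ← integral_const_mul]
  refine norm_integral_le_of_norm_le ((h₂.mul_const _).const_mul _) ?_
  filter_upwards [h₀] with x hx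
  have := norm_unitDir_add_sub_le hx (h - m)
  rwa [show m - x + (h - m) = h - x by abel] at this

omit [InnerProductSpace ℝ H] [CompleteSpace H] in
theorem integrable_norm_sub_norm (h : H) : Integrable (fun x => ‖x - h‖ - ‖x‖) μ := by
  refine Integrable.of_bound (by fun_prop) ‖h‖ (ae_of_all _ fun x => ?_)
  have := abs_norm_sub_norm_le (x - h) x
  simpa using this

/-- At a minimizer of the objective the gradient vanishes. -/
theorem medianGrad_eq_zero {m : H} (h₀ : ∀ᵐ x ∂μ, m - x ≠ 0)
    (h₁ : Integrable (fun x => ‖m - x‖⁻¹) μ) (h₂ : Integrable (fun x => ‖m - x‖⁻¹ ^ 2) μ)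
    (hm : ∀ h, ∫ x, (‖x - m‖ - ‖x‖) ∂μ ≤ ∫ x, (‖x - h‖ - ‖x‖) ∂μ) : medianGrad μ m = 0 := by
  -- The subgradient inequality at `h` bounds the increase of the objective from `m` to `h`, which
  -- minimality makes nonnegative.
  have hsub : ∀ h, 0 ≤ inner ℝ (h - m) (medianGrad μ h) := by
    intro h
    rw [inner_medianGrad]
    calc (0 : ℝ) ≤ ∫ x, (‖x - h‖ - ‖x‖) ∂μ - ∫ x, (‖x - m‖ - ‖x‖) ∂μ := sub_nonneg.2 (hm h)
      _ = ∫ x, ((‖x - h‖ - ‖x‖) - (‖x - m‖ - ‖x‖)) ∂μ :=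
        (integral_sub (integrable_norm_sub_norm h) (integrable_norm_sub_norm m)).symm
      _ ≤ _ := by
        refine integral_mono ((integrable_norm_sub_norm h).sub (integrable_norm_sub_norm m))
          ((integrable_unitDir h).const_inner _) fun x => ?_
        have := norm_add_inner_unitDir_le (h - x) (m - h)
        rw [show h - x + (m - h) = m - x by abel, real_inner_comm, ← neg_sub h m,
          inner_neg_left] at this
        simp only [norm_sub_rev x]
        linarith
  set g := medianGrad μ m with hg
  by_contra hne
  have hs : 0 < ‖g‖ ^ 2 := by positivity
  set B := ‖medianHess μ m g‖ * ‖g‖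
  set K := 3 * (∫ x, ‖m - x‖⁻¹ ^ 2 ∂μ) * ‖g‖ ^ 2 * ‖g‖
  have hB : 0 ≤ B := by positivity
  have hK : 0 ≤ K := by
    have : 0 ≤ ∫ x, ‖m - x‖⁻¹ ^ 2 ∂μ := integral_nonneg fun x => by positivity
    positivity
  have hsmul : ∀ t : ℝ, medianHess μ m (-(t • g)) = -(t • medianHess μ m g) := by
    intro t
    simp only [medianHess]
    rw [← integral_smul, ← integral_neg]
    refine integral_congr_ae (ae_of_all _ fun x => ?_)
    simp only [normHess, inner_neg_right, inner_smul_right]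
    module
  -- Test `hsub` at `m - t g`, where the expansion at `m` is available; a small `t` then contradicts
  -- `g ≠ 0`.
  have key : ∀ t : ℝ, 0 < t → ‖g‖ ^ 2 ≤ t * B + t ^ 2 * K := by
    intro t ht
    have e1 := hsub (m - t • g)
    rw [sub_sub_cancel_left, inner_neg_left, real_inner_smul_left] at e1
    have e2 := norm_medianGrad_sub_le h₀ h₁ h₂ (m - t • g)
    rw [sub_sub_cancel_left, hsmul, norm_neg, norm_smul, Real.norm_of_nonneg ht.le, ← hg] at e2
    set r := medianGrad μ (m - t • g) - g - -(t • medianHess μ m g) with hr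
    have e3 : medianGrad μ (m - t • g) = g - t • medianHess μ m g + r := by rw [hr]; abel
    rw [e3, inner_add_right, inner_sub_right, real_inner_smul_right,
      real_inner_self_eq_norm_sq] at e1
    have e4 : inner ℝ g (medianHess μ m g) ≤ B := by
      simpa [B, mul_comm] using real_inner_le_norm g (medianHess μ m g)
    have e5 : -inner ℝ g r ≤ t ^ 2 * K := by
      calc -inner ℝ g r ≤ ‖g‖ * ‖r‖ := neg_le_of_abs_le (abs_real_inner_le_norm _ _) |> neg_le.1
        _ ≤ ‖g‖ * (3 * (∫ x, ‖m - x‖⁻¹ ^ 2 ∂μ) * (t * ‖g‖) ^ 2) := by gcongr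
        _ = _ := by ring
    have e6 : ‖g‖ ^ 2 - t * inner ℝ g (medianHess μ m g) + inner ℝ g r ≤ 0 := by
      by_contra! h
      nlinarith [mul_pos ht h]
    nlinarith [mul_le_mul_of_nonneg_left e4 ht.le]
  set t := min 1 (‖g‖ ^ 2 / (2 * (B + K + 1))) with ht
  have ht0 : 0 < t := lt_min one_pos (by positivity)
  have h1 : t * (2 * (B + K + 1)) ≤ ‖g‖ ^ 2 := (le_div_iff₀ (by positivity)).1 (min_le_right _ _)
  have h2 : t ^ 2 * K ≤ t * K := by
    have : t ^ 2 ≤ t := by nlinarith [min_le_left 1 (‖g‖ ^ 2 / (2 * (B + K + 1)))]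
    gcongr
  nlinarith [key t ht0, mul_nonneg ht0.le hB, mul_nonneg ht0.le hK]

end MedianGradient

/-! ### Spectral gap of the Hessian and strong monotonicity -/

section Coercivity

variable {H : Type*} [NormedAddCommGroup H] [InnerProductSpace ℝ H]
  [MeasurableSpace H] [BorelSpace H] [SecondCountableTopology H] [CompleteSpace H]
  {μ : Measure H} [IsProbabilityMeasure μ]

omit [IsProbabilityMeasure μ] [CompleteSpace H] in
theorem integrable_inner_normHess {m : H} (h₁ : Integrable (fun x => ‖m - x‖⁻¹) μ) (k : H) :
    Integrable (fun x => inner ℝ (normHess (m - x) k) k) μ :=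
  (integrable_normHess h₁ k).inner_const k

omit [IsProbabilityMeasure μ] in
theorem inner_medianHess_self {m : H} (h₁ : Integrable (fun x => ‖m - x‖⁻¹) μ) (k : H) :
    inner ℝ (medianHess μ m k) k = ∫ x, inner ℝ (normHess (m - x) k) k ∂μ := by
  rw [real_inner_comm, medianHess, ← integral_inner (integrable_normHess h₁ k)]
  simp only [real_inner_comm]

omit [IsProbabilityMeasure μ] in
/-- If no line through `m` in the direction `e` carries `μ`, the Hessian is positive along `e`. -/
theorem inner_medianHess_self_pos {m : H} (h₀ : ∀ᵐ x ∂μ, m - x ≠ 0)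
    (h₁ : Integrable (fun x => ‖m - x‖⁻¹) μ) {e : H} (he : ‖e‖ = 1)
    (hline : ∃ h', inner ℝ e h' = 0 ∧ ¬ ∀ᵐ x ∂μ, inner ℝ x h' = inner ℝ m h') :
    0 < inner ℝ (medianHess μ m e) e := by
  rw [inner_medianHess_self h₁]
  refine (integral_nonneg fun x => inner_normHess_self_nonneg _ _).lt_of_ne' fun h => ?_
  rw [integral_eq_zero_iff_of_nonneg (fun x => inner_normHess_self_nonneg _ _)
    (integrable_inner_normHess h₁ e)] at h
  obtain ⟨h', heh, hne⟩ := hline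
  refine hne ?_
  filter_upwards [h, h₀] with x hx hx0
  simp only [inner_normHess_self, he, Pi.zero_apply, mul_eq_zero, inv_eq_zero, norm_eq_zero,
    hx0, false_or] at hx
  set u := unitDir (m - x)
  -- Vanishing of the integrand is the equality case of Cauchy–Schwarz, so `m - x` is parallel to
  -- `e`.
  have hu : u = (inner ℝ u e : ℝ) • e := by
    have : ‖u - (inner ℝ u e : ℝ) • e‖ ^ 2 = 0 := by
      rw [norm_sub_sq_real, norm_unitDir hx0, norm_smul, he, real_inner_smul_right,
        Real.norm_eq_abs, mul_one, sq_abs]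
      linarith
    exact sub_eq_zero.1 (norm_eq_zero.1 (pow_eq_zero_iff two_ne_zero |>.1 this))
  have : inner ℝ (m - x) h' = 0 := by
    rw [← norm_smul_unitDir (m - x), real_inner_smul_left, show unitDir (m - x) = u from rfl, hu,
      real_inner_smul_left, heh, mul_zero, mul_zero]
  rw [inner_sub_left] at this
  linarith

/-- A uniform spectral gap for the Hessian, obtained without compactness by comparing every
direction with the random direction itself. -/
theorem exists_medianHess_coercive {m : H} (h₀ : ∀ᵐ x ∂μ, m - x ≠ 0)
    (h₁ : Integrable (fun x => ‖m - x‖⁻¹) μ)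
    (hline : ∀ e : H, ‖e‖ = 1 →
      ∃ h', inner ℝ e h' = 0 ∧ ¬ ∀ᵐ x ∂μ, inner ℝ x h' = inner ℝ m h') :
    ∃ c : ℝ, 0 < c ∧ ∀ k, c * ‖k‖ ^ 2 ≤ inner ℝ (medianHess μ m k) k := by
  set τ := ∫ x, ‖m - x‖⁻¹ ∂μ with hτ
  set q : H → ℝ := fun k => inner ℝ (medianHess μ m k) k with hq
  have hτ0 : 0 < τ := by
    refine (integral_nonneg fun x => by positivity).lt_of_ne' fun h => ?_
    rw [integral_eq_zero_iff_of_nonneg (fun x => by positivity) h₁] at h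
    obtain ⟨x, hx, hx0⟩ := (h.and h₀).exists
    exact hx0 (by simpa using hx)
  have hqm : Measurable q := by
    have h2 : StronglyMeasurable (fun p : H × H => normHess (m - p.2) p.1) :=
      (measurable_normHess.comp (f := fun p : H × H => (m - p.2, p.1))
        (by fun_prop)).stronglyMeasurable
    have h3 : Measurable (medianHess μ m) := (h2.integral_prod_right' (ν := μ)).measurable
    exact h3.inner measurable_id
  have hq1 : ∀ u, ‖u‖ = 1 → q u ≤ τ := by
    intro u hu
    simp only [hq]
    rw [inner_medianHess_self h₁]
    refine integral_mono (integrable_inner_normHess h₁ u) h₁ fun x => ?_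
    simp only [inner_normHess_self, hu]
    have : 0 ≤ ‖m - x‖⁻¹ := by positivity
    nlinarith [mul_nonneg this (sq_nonneg (inner ℝ (unitDir (m - x)) u : ℝ))]
  have hq0 : ∀ u, 0 ≤ q u := by
    intro u
    simp only [hq]
    rw [inner_medianHess_self h₁]
    exact integral_nonneg fun x => inner_normHess_self_nonneg _ _
  have hqpos : ∀ u, ‖u‖ = 1 → 0 < q u := fun u hu => inner_medianHess_self_pos h₀ h₁ hu (hline u hu)
  -- `one_sub_inner_sq_le`, with the random direction as first vector, integrated against `‖m -
  -- x‖⁻¹`.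
  have hcomp : ∀ u k : H, ‖u‖ = 1 → ‖k‖ = 1 → q u ≤ 2 * q k + 2 * τ * (1 - inner ℝ u k ^ 2) := by
    intro u k hu hk
    simp only [hq]
    rw [inner_medianHess_self h₁, inner_medianHess_self h₁, mul_right_comm, ← integral_const_mul,
      mul_comm _ τ, ← integral_mul_const, ← integral_add ((integrable_inner_normHess h₁ k).const_mul _)
        (h₁.mul_const _)]
    refine integral_mono_ae (integrable_inner_normHess h₁ u)
      (((integrable_inner_normHess h₁ k).const_mul _).add (h₁.mul_const _)) ?_
    filter_upwards [h₀] with x hx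
    simp only [inner_normHess_self, hu, hk]
    have h3 := one_sub_inner_sq_le (norm_unitDir hx) hu hk
    have h4 : 0 ≤ ‖m - x‖⁻¹ := by positivity
    nlinarith [mul_le_mul_of_nonneg_left h3 h4]
  -- A weighted average of `q` over the random direction. It is positive because `q` is positive at
  -- every unit vector; no lower bound uniform in the direction is needed.
  set D := ∫ y, ‖m - y‖⁻¹ * q (unitDir (m - y)) ∂μ with hD
  have hDi : Integrable (fun y => ‖m - y‖⁻¹ * q (unitDir (m - y))) μ := by
    refine h₁.mul_const τ |>.mono' ?_ ?_
    · exact ((Measurable.norm (by fun_prop)).inv.mul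
        (hqm.comp (measurable_unitDir.comp (by fun_prop)))).aestronglyMeasurable
    · filter_upwards [h₀] with x hx
      rw [Real.norm_of_nonneg (mul_nonneg (by positivity) (hq0 _))]
      have := hq1 _ (norm_unitDir hx)
      gcongr
  have hDpos : 0 < D := by
    have hnn : ∀ y, 0 ≤ ‖m - y‖⁻¹ * q (unitDir (m - y)) :=
      fun y => mul_nonneg (by positivity) (hq0 _)
    refine (integral_nonneg hnn).lt_of_ne' fun h => ?_
    rw [integral_eq_zero_iff_of_nonneg hnn hDi] at h
    obtain ⟨x, hx, hx0⟩ := (h.and h₀).exists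
    have h5 := hqpos _ (norm_unitDir hx0)
    have h6 : 0 < ‖m - x‖⁻¹ := inv_pos.2 (norm_pos_iff.2 hx0)
    exact (mul_pos h6 h5).ne' hx
  -- Integrating `hcomp` with `u` the random direction turns its error term into `2 * τ * q k`, so
  -- the error is itself controlled by `q k`.
  have hunit : ∀ k, ‖k‖ = 1 → D ≤ 4 * τ * q k := by
    intro k hk
    have h7 : D ≤ ∫ y, (2 * q k * ‖m - y‖⁻¹ + 2 * τ * inner ℝ (normHess (m - y) k) k) ∂μ := by
      refine integral_mono_ae hDi
        ((h₁.const_mul _).add ((integrable_inner_normHess h₁ k).const_mul _)) ?_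
      filter_upwards [h₀] with y hy
      have h8 := hcomp _ k (norm_unitDir hy) hk
      have h9 : 0 ≤ ‖m - y‖⁻¹ := by positivity
      rw [inner_normHess_self, hk]
      nlinarith [mul_le_mul_of_nonneg_left h8 h9]
    rw [integral_add (h₁.const_mul _) ((integrable_inner_normHess h₁ k).const_mul _),
      integral_const_mul, integral_const_mul, ← inner_medianHess_self h₁, ← hτ] at h7
    change D ≤ 2 * q k * τ + 2 * τ * q k at h7
    linarith
  refine ⟨D / (4 * τ), by positivity, fun k => ?_⟩
  rcases eq_or_ne k 0 with rfl | hk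
  · simp
  have h10 := hunit (unitDir k) (norm_unitDir hk)
  have h11 : q k = ‖k‖ ^ 2 * q (unitDir k) := by
    simp only [hq]
    rw [inner_medianHess_self h₁, inner_medianHess_self h₁, ← integral_const_mul]
    refine integral_congr_ae (ae_of_all _ fun x => ?_)
    simp only [inner_normHess_self, norm_unitDir hk]
    have : (inner ℝ (unitDir (m - x)) k : ℝ) = ‖k‖ * inner ℝ (unitDir (m - x)) (unitDir k) := by
      rw [← real_inner_smul_right, norm_smul_unitDir]
    rw [this]
    ring
  change D / (4 * τ) * ‖k‖ ^ 2 ≤ q k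
  rw [h11, mul_comm]
  gcongr
  rw [div_le_iff₀ (by positivity)]
  linarith

/-- The gradient is strongly monotone with respect to `m`, uniformly on balls around `m`. -/
theorem exists_medianGrad_strongly_monotone {m : H} (h₀ : ∀ᵐ x ∂μ, m - x ≠ 0)
    (h₁ : Integrable (fun x => ‖m - x‖⁻¹) μ) (h₂ : Integrable (fun x => ‖m - x‖⁻¹ ^ 2) μ)
    (hm : medianGrad μ m = 0) {c : ℝ} (hc : 0 < c)
    (hΓ : ∀ k, c * ‖k‖ ^ 2 ≤ inner ℝ (medianHess μ m k) k) (A : ℝ) :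
    ∃ c' : ℝ, 0 < c' ∧ ∀ h, ‖h - m‖ ≤ A → c' * ‖h - m‖ ^ 2 ≤ inner ℝ (h - m) (medianGrad μ h) := by
  set K := 3 * ∫ x, ‖m - x‖⁻¹ ^ 2 ∂μ
  have hK : 0 ≤ K := mul_nonneg (by norm_num) (integral_nonneg fun x => by positivity)
  -- Within radius `r` the quadratic remainder consumes at most half of the coercivity constant.
  set r := c / (2 * (K + 1)) with hr
  have hr0 : 0 < r := by positivity
  have hrK : K * r ≤ c / 2 := by
    rw [hr, mul_div_assoc', div_le_iff₀ (by positivity)]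
    nlinarith
  have hnear : ∀ h, ‖h - m‖ ≤ r → c / 2 * ‖h - m‖ ^ 2 ≤ inner ℝ (h - m) (medianGrad μ h) := by
    intro h hh
    have e1 := norm_medianGrad_sub_le h₀ h₁ h₂ h
    rw [hm, sub_zero] at e1
    set ρ := medianGrad μ h - medianHess μ m (h - m) with hρ
    have e2 : medianGrad μ h = medianHess μ m (h - m) + ρ := by rw [hρ]; abel
    have e3 : -(‖h - m‖ * ‖ρ‖) ≤ inner ℝ (h - m) ρ := neg_le_of_abs_le (abs_real_inner_le_norm _ _)
    have e4 := hΓ (h - m)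
    rw [e2, inner_add_right, real_inner_comm]
    have e5 : ‖h - m‖ * ‖ρ‖ ≤ c / 2 * ‖h - m‖ ^ 2 := by
      calc ‖h - m‖ * ‖ρ‖ ≤ ‖h - m‖ * (K * ‖h - m‖ ^ 2) := by gcongr
        _ = K * ‖h - m‖ * ‖h - m‖ ^ 2 := by ring
        _ ≤ K * r * ‖h - m‖ ^ 2 := by gcongr
        _ ≤ _ := by gcongr
    linarith
  refine ⟨min (c / 2) (c / 2 * r / (|A| + 1)), by positivity, fun h hA => ?_⟩
  rcases le_or_gt ‖h - m‖ r with hh | hh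
  · refine le_trans ?_ (hnear h hh)
    gcongr
    exact min_le_left _ _
  set d := ‖h - m‖ with hd
  have hd0 : 0 < d := hr0.trans hh
  set t := r / d
  have ht0 : 0 < t := by positivity
  have ht1 : t < 1 := (div_lt_one hd0).2 hh
  -- The point of the segment from `m` to `h` at distance `r`. Monotonicity carries the bound from
  -- `h'` out to `h`, where it is only linear in the distance; the bound `A` makes it quadratic.
  set h' := m + t • (h - m) with hh'
  have e1 : h' - m = t • (h - m) := by rw [hh']; abel
  have e2 : ‖h' - m‖ = r := by
    rw [e1, norm_smul, Real.norm_of_nonneg ht0.le, ← hd]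
    exact div_mul_cancel₀ _ hd0.ne'
  have e3 := hnear h' e2.le
  rw [e2, e1, real_inner_smul_left] at e3
  have e4 := inner_medianGrad_sub_nonneg (μ := μ) h h'
  have e5 : h - h' = (1 - t) • (h - m) := by rw [hh']; module
  rw [e5, real_inner_smul_right, real_inner_comm, inner_sub_right] at e4
  have e6 := nonneg_of_mul_nonneg_right e4 (by linarith)
  have e7 : c / 2 * r * d ≤ inner ℝ (h - m) (medianGrad μ h') := by
    have : t * (c / 2 * r * d) = c / 2 * r ^ 2 := by
      simp only [t]; field_simp
    rw [← this] at e3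
    exact le_of_mul_le_mul_left e3 ht0
  have e8 : min (c / 2) (c / 2 * r / (|A| + 1)) * d ≤ c / 2 * r := by
    calc _ ≤ c / 2 * r / (|A| + 1) * d := by gcongr; exact min_le_right _ _
      _ ≤ c / 2 * r / (|A| + 1) * (|A| + 1) := by gcongr; linarith [le_abs_self A]
      _ = _ := by field_simp
  nlinarith [mul_le_mul_of_nonneg_right e8 hd0.le]

end Coercivity

/-! ### Independence and the Robbins–Siegmund theorem -/

section Probability

variable {Ω : Type*} {𝓖 mΩ : MeasurableSpace Ω} {P : Measure Ω} [IsProbabilityMeasure P]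

/-- Integrating out a variable that is independent of a sub-σ-algebra. -/
theorem setIntegral_comp_eq_of_indep {E F : Type*} [MeasurableSpace E] [MeasurableSpace F]
    (h𝓖 : 𝓖 ≤ mΩ) {Y : Ω → E} (hY : Measurable[𝓖] Y) {x : Ω → F}
    (hx : Measurable x) (hind : Indep 𝓖 (MeasurableSpace.comap x inferInstance) P)
    {f : E × F → ℝ} (hf : Measurable f) (hfi : Integrable (fun ω => f (Y ω, x ω)) P)
    {s : Set Ω} (hs : MeasurableSet[𝓖] s) :
    ∫ ω in s, f (Y ω, x ω) ∂P = ∫ ω in s, (∫ y, f (Y ω, y) ∂(P.map x)) ∂P := by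
  have hY' : Measurable Y := hY.mono h𝓖 le_rfl
  -- Restricting to an event of `𝓖` keeps `x` independent of `Y` and leaves its law unchanged, so
  -- the joint law is a product.
  have hlaw : (P.restrict s).map (fun ω => (Y ω, x ω)) =
      ((P.restrict s).map Y).prod (P.map x) := by
    have : IsProbabilityMeasure (P.map x) := Measure.isProbabilityMeasure_map hx.aemeasurable
    refine (Measure.prod_eq fun A B hA hB => ?_).symm
    rw [Measure.map_apply (hY'.prodMk hx) (hA.prod hB), Measure.map_apply hY' hA,
      Measure.map_apply hx hB, Measure.restrict_apply (hY' hA),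
      Measure.restrict_apply ((hY'.prodMk hx) (hA.prod hB))]
    have h1 := (Indep_iff _ _ P).1 hind (Y ⁻¹' A ∩ s) (x ⁻¹' B)
      ((hY hA).inter hs) ⟨B, hB, rfl⟩
    rw [← h1]
    congr 1
    ext ω
    simp only [Set.mem_inter_iff, Set.mem_preimage, Set.mem_prod]
    tauto
  have : IsProbabilityMeasure (P.map x) := Measure.isProbabilityMeasure_map hx.aemeasurable
  have hfi' : Integrable f (((P.restrict s).map Y).prod (P.map x)) := by
    rw [← hlaw, integrable_map_measure hf.aestronglyMeasurable (hY'.prodMk hx).aemeasurable]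
    exact hfi.integrableOn
  calc ∫ ω in s, f (Y ω, x ω) ∂P = ∫ q, f q ∂((P.restrict s).map (fun ω => (Y ω, x ω))) :=
        (integral_map (hY'.prodMk hx).aemeasurable hf.aestronglyMeasurable).symm
    _ = ∫ a, ∫ y, f (a, y) ∂(P.map x) ∂((P.restrict s).map Y) := by
        rw [hlaw, integral_prod _ hfi']
    _ = _ := integral_map hY'.aemeasurable
        (hf.stronglyMeasurable.integral_prod_right' (ν := P.map x)).aestronglyMeasurable

/-- The **Robbins–Siegmund theorem** for deterministic contraction and error sequences. -/
theorem ae_bdd_and_summable_of_setIntegral_succ_le {ℱ : Filtration ℕ mΩ} {A : ℕ → Ω → ℝ}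
    {p ν : ℕ → ℝ} (hadp : StronglyAdapted ℱ A) (hint : ∀ n, Integrable (A n) P)
    (hA : ∀ n ω, 0 ≤ A n ω) (hp : ∀ n, 0 ≤ p n) (hν : ∀ n, 0 ≤ ν n) (hνs : Summable ν)
    (hstep : ∀ n s, MeasurableSet[ℱ n] s →
      ∫ ω in s, A (n + 1) ω ∂P ≤ ∫ ω in s, ((1 - p n) * A n ω + ν n) ∂P) :
    ∀ᵐ ω ∂P, (∃ K, ∀ n, A n ω ≤ K) ∧ Summable fun n => p n * A n ω := by
  -- A supermartingale bounded below by `-T`, hence almost surely convergent; its limit bounds both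
  -- `A n` and the partial sums of `p i * A i`.
  set S : ℕ → Ω → ℝ := fun n ω =>
    A n ω + (∑ i ∈ Finset.range n, p i * A i ω - ∑ i ∈ Finset.range n, ν i) with hS
  set T := ∑' i, ν i
  have hT : ∀ n, ∑ i ∈ Finset.range n, ν i ≤ T := fun n => hνs.sum_le_tsum _ fun i _ => hν i
  have hSint : ∀ n, Integrable (S n) P := fun n =>
    (hint n).add ((integrable_finsetSum _ fun i _ => (hint i).const_mul _).sub
      (integrable_const _))
  have hSadp : StronglyAdapted ℱ S := by
    intro n
    refine (hadp n).add (StronglyMeasurable.sub ?_ stronglyMeasurable_const)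
    refine Finset.stronglyMeasurable_fun_sum _ fun i hi => ?_
    exact ((hadp i).mono (ℱ.mono (Finset.mem_range.1 hi).le)).const_mul _
  have hsuper : Supermartingale S ℱ P := by
    refine supermartingale_of_setIntegral_succ_le hSadp hSint fun n s hs => ?_
    have e1 : ∀ ω, S (n + 1) ω = A (n + 1) ω + (S n ω - ((1 - p n) * A n ω + ν n)) := by
      intro ω
      simp only [hS, Finset.sum_range_succ]
      ring
    have hi : Integrable (fun ω => (1 - p n) * A n ω + ν n) P :=
      ((hint n).const_mul _).add (integrable_const _)
    simp only [e1]
    rw [integral_add (g := fun ω => S n ω - ((1 - p n) * A n ω + ν n)) (hint _).integrableOn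
        ((hSint n).sub hi).integrableOn,
      integral_sub (hSint n).integrableOn hi.integrableOn]
    linarith [hstep n s hs]
  have hlow : ∀ n ω, A n ω + ∑ i ∈ Finset.range n, p i * A i ω ≤ S n ω + T := by
    intro n ω
    have := hT n
    simp only [hS]
    linarith
  have hT0 : 0 ≤ T := tsum_nonneg hν
  have hbdd : ∀ n, eLpNorm ((-S) n) 1 P ≤ (∫ ω, S 0 ω ∂P + 2 * T).toNNReal := by
    intro n
    rw [Pi.neg_apply, eLpNorm_neg, eLpNorm_one_eq_lintegral_enorm,
      ← ofReal_integral_norm_eq_lintegral_enorm (hSint n)]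
    refine ENNReal.ofReal_le_ofReal ?_
    -- From `S n ≥ -T` follows `|S n| ≤ S n + 2T`, so decreasing means suffice for an `L¹` bound.
    have h1 : ∫ ω, ‖S n ω‖ ∂P ≤ ∫ ω, (S n ω + 2 * T) ∂P := by
      refine integral_mono (hSint n).norm ((hSint n).add (integrable_const _)) fun ω => ?_
      have h2 := hlow n ω
      have h3 : 0 ≤ ∑ i ∈ Finset.range n, p i * A i ω :=
        Finset.sum_nonneg fun i _ => mul_nonneg (hp i) (hA i ω)
      have h4 := hA n ω
      rw [Real.norm_eq_abs]
      exact abs_le.2 ⟨by linarith, by linarith⟩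
    rw [integral_add (hSint n) (integrable_const _)] at h1
    have h5 := hsuper.setIntegral_le (Nat.zero_le n) MeasurableSet.univ
    simp only [Measure.restrict_univ] at h5
    simp only [integral_const, probReal_univ, one_smul] at h1
    linarith
  filter_upwards [hsuper.neg.exists_ae_tendsto_of_bdd hbdd] with ω ⟨c, hc⟩
  obtain ⟨K, hK⟩ := hc.neg.bddAbove_range
  have hK' : ∀ n, S n ω ≤ K := fun n => by
    have := hK ⟨n, rfl⟩
    simpa using this
  have hsum0 : ∀ n, 0 ≤ ∑ i ∈ Finset.range n, p i * A i ω := fun n =>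
    Finset.sum_nonneg fun i _ => mul_nonneg (hp i) (hA i ω)
  refine ⟨⟨K + T, fun n => ?_⟩, ?_⟩
  · linarith [hlow n ω, hK' n, hsum0 n]
  · refine summable_of_sum_range_le (c := K + T) (fun n => mul_nonneg (hp n) (hA n ω)) fun n => ?_
    linarith [hlow n ω, hK' n, hA n ω]

/-- The Robbins–Siegmund theorem when the recursive inequality only holds from some index on. -/
theorem ae_bdd_and_summable_of_eventually_setIntegral_succ_le {ℱ : Filtration ℕ mΩ}
    {A : ℕ → Ω → ℝ} {p ν : ℕ → ℝ} (hadp : StronglyAdapted ℱ A) (hint : ∀ n, Integrable (A n) P)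
    (hA : ∀ n ω, 0 ≤ A n ω) (hp : ∀ n, 0 ≤ p n) (hν : ∀ n, 0 ≤ ν n) (hνs : Summable ν) (n₀ : ℕ)
    (hstep : ∀ n s, n₀ ≤ n → MeasurableSet[ℱ n] s →
      ∫ ω in s, A (n + 1) ω ∂P ≤ ∫ ω in s, ((1 - p n) * A n ω + ν n) ∂P) :
    ∀ᵐ ω ∂P, (∃ K, ∀ n, A n ω ≤ K) ∧ Summable fun n => p n * A n ω := by
  let 𝒢 : Filtration ℕ mΩ :=
    ⟨fun n => ℱ (n + n₀), fun i j hij => ℱ.mono (by omega), fun i => ℱ.le _⟩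
  have h := ae_bdd_and_summable_of_setIntegral_succ_le (P := P) (ℱ := 𝒢)
    (A := fun n => A (n + n₀)) (p := fun n => p (n + n₀)) (ν := fun n => ν (n + n₀))
    (fun n => hadp (n + n₀)) (fun n => hint _) (fun n => hA _) (fun n => hp _) (fun n => hν _)
    ((summable_nat_add_iff n₀).2 hνs) (fun n s hs => by
      have := hstep (n + n₀) s (by omega) hs
      rwa [add_right_comm] at this)
  filter_upwards [h] with ω ⟨⟨K, hK⟩, hs⟩
  refine ⟨⟨max K (∑ i ∈ Finset.range n₀, A i ω), fun n => ?_⟩, (summable_nat_add_iff n₀).1 hs⟩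
  rcases lt_or_ge n n₀ with hn | hn
  · exact le_max_of_le_right (Finset.single_le_sum (f := fun i => A i ω) (fun i _ => hA i ω)
      (Finset.mem_range.2 hn))
  · obtain ⟨k, rfl⟩ := Nat.exists_eq_add_of_le' hn
    exact le_max_of_le_left (hK k)

end Probability

/-! ### Almost sure rates for the iterates and for the noise -/

section StochasticGradient

variable {Ω H : Type*} {mΩ : MeasurableSpace Ω} {P : Measure Ω} [IsProbabilityMeasure P]
  [NormedAddCommGroup H] [InnerProductSpace ℝ H] [MeasurableSpace H]

/-- A stochastic gradient process for the geometric median of the law `μ`, driven by independent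
samples `x n` of `μ`, with deterministic steps `γ n` and bounded initialization. -/
structure IsMedianSGD (P : Measure Ω) (μ : Measure H) (ℱ : Filtration ℕ mΩ) (γ : ℕ → ℝ)
    (x z : ℕ → Ω → H) : Prop where
  measurable_sample : ∀ n, Measurable (x n)
  indep : ∀ n, Indep (ℱ n) (MeasurableSpace.comap (x n) inferInstance) P
  law : ∀ n, P.map (x n) = μ
  measurable_sample_succ : ∀ n, Measurable[ℱ (n + 1)] (x n)
  measurable_init : Measurable[ℱ 0] (z 0)
  step : ∀ n ω, z (n + 1) ω = z n ω - γ n • unitDir (z n ω - x n ω)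
  bounded_init : ∃ M : ℝ, ∀ᵐ ω ∂P, ‖z 0 ω‖ ≤ M

/-- The sum of the first `n` martingale differences `Φ(z i) - U(z i - x i)`. -/
noncomputable def gradNoise (μ : Measure H) (x z : ℕ → Ω → H) (n : ℕ) (ω : Ω) : H :=
  ∑ i ∈ Finset.range n, (medianGrad μ (z i ω) - unitDir (z i ω - x i ω))

namespace IsMedianSGD

variable [BorelSpace H] [SecondCountableTopology H]
  {μ : Measure H} [IsProbabilityMeasure μ] {ℱ : Filtration ℕ mΩ} {γ : ℕ → ℝ} {x z : ℕ → Ω → H}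

omit [IsProbabilityMeasure P] [IsProbabilityMeasure μ] in
theorem measurable (h : IsMedianSGD P μ ℱ γ x z) (n : ℕ) : Measurable[ℱ n] (z n) := by
  induction n with
  | zero => exact h.measurable_init
  | succ n ih =>
    have h1 : Measurable[ℱ (n + 1)] (z n) := ih.mono (ℱ.mono n.le_succ) le_rfl
    rw [funext (h.step n)]
    exact h1.sub ((measurable_unitDir.comp (h1.sub (h.measurable_sample_succ n))).const_smul _)

omit [IsProbabilityMeasure P] in
theorem measurable_gradNoise (h : IsMedianSGD P μ ℱ γ x z) (n : ℕ) :
    Measurable[ℱ n] (gradNoise μ x z n) := by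
  refine Finset.measurable_fun_sum _ fun i hi => ?_
  have hi := Finset.mem_range.1 hi
  have h1 : Measurable[ℱ n] (z i) := (h.measurable i).mono (ℱ.mono hi.le) le_rfl
  have h2 : Measurable[ℱ n] (x i) := (h.measurable_sample_succ i).mono (ℱ.mono hi) le_rfl
  exact (measurable_medianGrad.comp h1).sub (measurable_unitDir.comp (h1.sub h2))

omit [IsProbabilityMeasure P] [BorelSpace H] [SecondCountableTopology H]
  [IsProbabilityMeasure μ] in
-- A step has length at most `|γ n|`, so at each fixed time the iterate is essentially bounded.
-- Integrability thus needs no moment of the samples.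
theorem exists_ae_norm_sub_le (h : IsMedianSGD P μ ℱ γ x z) (m : H) (n : ℕ) :
    ∃ K : ℝ, ∀ᵐ ω ∂P, ‖z n ω - m‖ ≤ K := by
  induction n with
  | zero =>
    obtain ⟨M, hM⟩ := h.bounded_init
    refine ⟨M + ‖m‖, hM.mono fun ω hω => (norm_sub_le _ _).trans ?_⟩
    gcongr
  | succ n ih =>
    obtain ⟨K, hK⟩ := ih
    refine ⟨K + |γ n|, hK.mono fun ω hω => ?_⟩
    rw [h.step, sub_right_comm]
    refine (norm_sub_le _ _).trans (add_le_add hω ?_)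
    rw [norm_smul, Real.norm_eq_abs]
    exact mul_le_of_le_one_right (abs_nonneg _) (norm_unitDir_le _)

omit [IsProbabilityMeasure μ] in
theorem integrable_norm_sub_sq (h : IsMedianSGD P μ ℱ γ x z) (m : H) (n : ℕ) :
    Integrable (fun ω => ‖z n ω - m‖ ^ 2) P := by
  obtain ⟨K, hK⟩ := h.exists_ae_norm_sub_le m n
  have hz : Measurable (z n) := (h.measurable n).mono (ℱ.le n) le_rfl
  refine Integrable.of_bound (by fun_prop) (K ^ 2) (hK.mono fun ω hω => ?_)
  rw [Real.norm_of_nonneg (by positivity)]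
  gcongr

variable [CompleteSpace H]

/-- The martingale difference property in weak form: `x n` is independent of the past, so
integrating it out replaces the direction by the gradient. It serves with `w = z n - m` and with `w`
the accumulated noise. -/
theorem setIntegral_inner_unitDir (h : IsMedianSGD P μ ℱ γ x z) {n : ℕ} {w : Ω → H}
    (hw : Measurable[ℱ n] w) (hwi : Integrable w P) {s : Set Ω} (hs : MeasurableSet[ℱ n] s) :
    ∫ ω in s, inner ℝ (w ω) (unitDir (z n ω - x n ω)) ∂P =
      ∫ ω in s, inner ℝ (w ω) (medianGrad μ (z n ω)) ∂P := by
  have hz : Measurable (z n) := (h.measurable n).mono (ℱ.le n) le_rfl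
  have hwm : Measurable w := hw.mono (ℱ.le n) le_rfl
  have hf : Measurable (fun q : (H × H) × H => (inner ℝ q.1.1 (unitDir (q.1.2 - q.2)) : ℝ)) :=
    Measurable.inner (by fun_prop) (measurable_unitDir.comp (by fun_prop))
  have hi : Integrable (fun ω => (inner ℝ (w ω) (unitDir (z n ω - x n ω)) : ℝ)) P := by
    refine hwi.norm.mono' ?_ (ae_of_all _ fun ω => ?_)
    · exact (hwm.inner (measurable_unitDir.comp
        (hz.sub (h.measurable_sample n)))).aestronglyMeasurable
    · rw [Real.norm_eq_abs, real_inner_comm]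
      refine (abs_real_inner_le_norm _ _).trans ?_
      exact mul_le_of_le_one_left (norm_nonneg _) (norm_unitDir_le _)
  rw [setIntegral_comp_eq_of_indep (ℱ.le n) (Y := fun ω => (w ω, z n ω)) (hw.prodMk (h.measurable n))
    (h.measurable_sample n) (h.indep n) hf hi hs, h.law n]
  simp only [inner_medianGrad]

/-- Expand the square: the cross term averages to the gradient and the direction has norm at most
`1`. Asking for `hc` only on `s` permits localization. -/
theorem setIntegral_norm_sub_sq_succ_le (h : IsMedianSGD P μ ℱ γ x z) (m : H) (n : ℕ) {s : Set Ω}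
    (hs : MeasurableSet[ℱ n] s) (hγ : 0 < γ n) {c : ℝ}
    (hc : ∀ ω ∈ s, c * ‖z n ω - m‖ ^ 2 ≤ inner ℝ (z n ω - m) (medianGrad μ (z n ω))) :
    ∫ ω in s, ‖z (n + 1) ω - m‖ ^ 2 ∂P ≤
      ∫ ω in s, ((1 - 2 * c * γ n) * ‖z n ω - m‖ ^ 2 + γ n ^ 2) ∂P := by
  have hz : Measurable (z n) := (h.measurable n).mono (ℱ.le n) le_rfl
  obtain ⟨K, hK⟩ := h.exists_ae_norm_sub_le m n
  have hV : Integrable (fun ω => z n ω - m) P :=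
    Integrable.of_bound (hz.sub_const m).aestronglyMeasurable K hK
  have hinner : ∀ u : Ω → H, Measurable u → (∀ ω, ‖u ω‖ ≤ 1) →
      Integrable (fun ω => (inner ℝ (z n ω - m) (u ω) : ℝ)) P := by
    intro u hu hu1
    refine hV.norm.mono' ((hz.sub_const m).inner hu).aestronglyMeasurable
      (ae_of_all _ fun ω => ?_)
    rw [Real.norm_eq_abs]
    exact (abs_real_inner_le_norm _ _).trans (mul_le_of_le_one_right (norm_nonneg _) (hu1 ω))
  have hi1 := hinner (fun ω => unitDir (z n ω - x n ω))
    (measurable_unitDir.comp (hz.sub (h.measurable_sample n))) fun ω => norm_unitDir_le _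
  have hi2 := hinner (fun ω => medianGrad μ (z n ω)) (measurable_medianGrad.comp hz)
    fun ω => norm_medianGrad_le _
  have hW := h.integrable_norm_sub_sq m n
  have hexp : ∀ u : Ω → ℝ, Integrable u P →
      ∫ ω in s, (‖z n ω - m‖ ^ 2 - 2 * γ n * u ω + γ n ^ 2) ∂P =
        ∫ ω in s, ‖z n ω - m‖ ^ 2 ∂P - 2 * γ n * ∫ ω in s, u ω ∂P + ∫ _ in s, γ n ^ 2 ∂P := by
    intro u hu
    have hd : Integrable (fun ω => ‖z n ω - m‖ ^ 2 - 2 * γ n * u ω) P := hW.sub (hu.const_mul _)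
    rw [integral_add hd.integrableOn (integrable_const _),
      integral_sub hW.integrableOn (hu.const_mul _).integrableOn, integral_const_mul]
  have hfinal : ∫ ω in s, (‖z n ω - m‖ ^ 2 - 2 * γ n *
      inner ℝ (z n ω - m) (medianGrad μ (z n ω)) + γ n ^ 2) ∂P ≤
      ∫ ω in s, ((1 - 2 * c * γ n) * ‖z n ω - m‖ ^ 2 + γ n ^ 2) ∂P := by
    refine setIntegral_mono_on ((hW.sub (hi2.const_mul _)).add (integrable_const _)).integrableOn
      ((hW.const_mul _).add (integrable_const _)).integrableOn (ℱ.le n s hs) fun ω hω => ?_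
    nlinarith [mul_le_mul_of_nonneg_left (hc ω hω) hγ.le]
  refine le_trans ?_ hfinal
  rw [hexp _ hi2, ← h.setIntegral_inner_unitDir ((h.measurable n).sub_const m) hV hs, ← hexp _ hi1]
  refine integral_mono (h.integrable_norm_sub_sq m (n + 1)).integrableOn
    ((hW.sub (hi1.const_mul _)).add (integrable_const _)).integrableOn fun ω => ?_
  simp only
  rw [h.step, sub_right_comm, norm_sub_sq_real, norm_smul, real_inner_smul_right, mul_pow,
    Real.norm_eq_abs, sq_abs]
  have := norm_unitDir_le (z n ω - x n ω)
  have : ‖unitDir (z n ω - x n ω)‖ ^ 2 ≤ 1 := pow_le_one₀ (norm_nonneg _) this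
  nlinarith [sq_nonneg (γ n)]

omit [IsProbabilityMeasure P] [IsProbabilityMeasure μ] [CompleteSpace H] in
theorem stronglyMeasurable_norm_sub_sq (h : IsMedianSGD P μ ℱ γ x z) (m : H) (n : ℕ) :
    StronglyMeasurable[ℱ n] fun ω => ‖z n ω - m‖ ^ 2 := by
  have h1 : Measurable[ℱ n] fun ω => ‖z n ω - m‖ := measurable_norm.comp ((h.measurable n).sub_const m)
  exact (h1.pow_const 2).stronglyMeasurable

/-- Robbins–Siegmund with zero contraction: monotonicity alone gives boundedness, which starts the
localization in `ae_rate`. -/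
theorem ae_bdd_norm_sub_sq (h : IsMedianSGD P μ ℱ γ x z) {m : H}
    (hγ : ∀ n, 0 < γ n) (hγ2 : Summable fun n => γ n ^ 2)
    (hmono : ∀ y, 0 ≤ inner ℝ (y - m) (medianGrad μ y)) :
    ∀ᵐ ω ∂P, ∃ K, ∀ n, ‖z n ω - m‖ ^ 2 ≤ K := by
  refine (ae_bdd_and_summable_of_setIntegral_succ_le (P := P) (ℱ := ℱ)
    (A := fun n ω => ‖z n ω - m‖ ^ 2) (p := 0) (ν := fun n => γ n ^ 2)
    (h.stronglyMeasurable_norm_sub_sq m)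
    (h.integrable_norm_sub_sq m) (fun n ω => by positivity) (fun n => le_rfl)
    (fun n => by positivity) hγ2 fun n s hs => ?_).mono fun ω hω => hω.1
  have := h.setIntegral_norm_sub_sq_succ_le m n hs (hγ n) (c := 0) fun ω _ => by
    rw [zero_mul]; exact hmono _
  simpa using this

/-- Almost sure rate of convergence of the iterates: with a weight `b` such that `∑ 1 / b n < ∞`,
`‖z n - m‖ = O(γ n √(b n))`, together with a summability statement for the squared distances. -/
theorem ae_rate (h : IsMedianSGD P μ ℱ γ x z) {m : H}
    (hγ : ∀ n, 0 < γ n) (hγ2 : Summable fun n => γ n ^ 2)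
    (hmono : ∀ y, 0 ≤ inner ℝ (y - m) (medianGrad μ y))
    (hstrong : ∀ A : ℝ, ∃ c : ℝ, 0 < c ∧
      ∀ y, ‖y - m‖ ≤ A → c * ‖y - m‖ ^ 2 ≤ inner ℝ (y - m) (medianGrad μ y))
    {b : ℕ → ℝ} (hb : ∀ n, 0 < b n) (hbmono : Monotone b) (hbs : Summable fun n => (b n)⁻¹)
    {R : ℝ} (hR : ∀ n, γ n ^ 2 ≤ R * γ (n + 1) ^ 2)
    (hcontr : ∀ c : ℝ, 0 < c → ∀ᶠ n in atTop, 0 ≤ 1 - 2 * c * γ n ∧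
      γ n ^ 2 * (1 - 2 * c * γ n) ≤ γ (n + 1) ^ 2 * (1 - c * γ n)) :
    ∀ᵐ ω ∂P, (∃ K, ∀ n, ‖z n ω - m‖ ^ 2 ≤ K * (γ n ^ 2 * b n)) ∧
      Summable fun n => ‖z n ω - m‖ ^ 2 / (γ n * b n) := by
  set a : ℕ → ℝ := fun n => (γ n ^ 2 * b n)⁻¹ with ha
  have ha0 : ∀ n, 0 < a n := fun n => inv_pos.2 (mul_pos (pow_pos (hγ n) 2) (hb n))
  -- Strong monotonicity holds only on balls, so the process is killed once it leaves radius `N`.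
  -- These events decrease in `n`, which preserves the recursive inequality.
  set B : ℕ → ℕ → Set Ω := fun N n => {ω | ∀ j ≤ n, ‖z j ω - m‖ ≤ N} with hB
  have hBmeas : ∀ N n, MeasurableSet[ℱ n] (B N n) := by
    intro N n
    have : B N n = ⋂ j, ⋂ (_ : j ≤ n), {ω | ‖z j ω - m‖ ≤ N} := by
      ext ω; simp [hB]
    rw [this]
    refine MeasurableSet.iInter fun j => MeasurableSet.iInter fun hj => ?_
    have h1 : Measurable[ℱ n] fun ω => ‖z j ω - m‖ :=
      measurable_norm.comp (((h.measurable j).mono (ℱ.mono hj) le_rfl).sub_const m)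
    exact h1 measurableSet_Iic
  have hBanti : ∀ N n, B N (n + 1) ⊆ B N n := fun N n ω hω j hj => hω j (hj.trans n.le_succ)
  have hloc : ∀ N : ℕ, ∃ c : ℝ, 0 < c ∧ ∀ᵐ ω ∂P,
      (∃ K, ∀ n, (B N n).indicator (fun ω => a n * ‖z n ω - m‖ ^ 2) ω ≤ K) ∧
      Summable fun n => c * γ n * (B N n).indicator (fun ω => a n * ‖z n ω - m‖ ^ 2) ω := by
    intro N
    obtain ⟨c, hc, hcN⟩ := hstrong N
    refine ⟨c, hc, ?_⟩
    obtain ⟨n₀, hn₀⟩ := eventually_atTop.1 (hcontr c hc)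
    have hint : ∀ n, Integrable (fun ω => a n * ‖z n ω - m‖ ^ 2) P := fun n =>
      (h.integrable_norm_sub_sq m n).const_mul _
    have hR0 : 0 ≤ R := by
      by_contra! hneg
      nlinarith [hR 0, pow_pos (hγ 0) 2, pow_pos (hγ 1) 2]
    refine ae_bdd_and_summable_of_eventually_setIntegral_succ_le (P := P) (ℱ := ℱ)
      (ν := fun n => R * (b (n + 1))⁻¹) (fun n => ?_) (fun n => ?_) (fun n ω => ?_)
      (fun n => by have := hγ n; positivity) (fun n => by have := hb (n + 1); positivity)
      (((summable_nat_add_iff 1).2 hbs).mul_left R) n₀ fun n s hn hs => ?_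
    · exact ((h.stronglyMeasurable_norm_sub_sq m n).const_mul (a n)).indicator (hBmeas N n)
    · exact (hint n).indicator (ℱ.le n _ (hBmeas N n))
    · exact Set.indicator_nonneg (fun ω _ => by have := ha0 n; positivity) _
    obtain ⟨e1, e2⟩ := hn₀ n hn
    have hsB : MeasurableSet[ℱ n] (s ∩ B N n) := hs.inter (hBmeas N n)
    have hstep := h.setIntegral_norm_sub_sq_succ_le m n hsB (hγ n)
      fun ω hω => hcN (z n ω) (hω.2 n le_rfl)
    -- Half of the drift `2 * c * γ n` pays for the growth of the weight `a`; the other half remains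
    -- as the contraction `c * γ n` and yields the summability.
    have hcoef : a (n + 1) * (1 - 2 * c * γ n) ≤ (1 - c * γ n) * a n := by
      have h1 : 0 < γ n ^ 2 := pow_pos (hγ n) 2
      have h2 : 0 < γ (n + 1) ^ 2 := pow_pos (hγ (n + 1)) 2
      have h3 := hb n
      have h4 := hb (n + 1)
      have h5 : b n ≤ b (n + 1) := hbmono n.le_succ
      simp only [ha]
      rw [inv_mul_eq_div, ← div_eq_mul_inv, div_le_div_iff₀ (by positivity) (by positivity)]
      calc (1 - 2 * c * γ n) * (γ n ^ 2 * b n) = γ n ^ 2 * (1 - 2 * c * γ n) * b n := by ring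
        _ ≤ γ n ^ 2 * (1 - 2 * c * γ n) * b (n + 1) := by gcongr
        _ ≤ γ (n + 1) ^ 2 * (1 - c * γ n) * b (n + 1) := by gcongr
        _ = _ := by ring
    have herr : a (n + 1) * γ n ^ 2 ≤ R * (b (n + 1))⁻¹ := by
      have h2 : 0 < γ (n + 1) ^ 2 := pow_pos (hγ (n + 1)) 2
      have h4 := hb (n + 1)
      simp only [ha]
      rw [inv_mul_eq_div, ← div_eq_mul_inv, div_le_div_iff₀ (by positivity) (by positivity)]
      nlinarith [mul_le_mul_of_nonneg_right (hR n) h4.le]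
    have hnn : ∀ k ω, 0 ≤ a k * ‖z k ω - m‖ ^ 2 := fun k ω => by have := ha0 k; positivity
    calc ∫ ω in s, (B N (n + 1)).indicator (fun ω => a (n + 1) * ‖z (n + 1) ω - m‖ ^ 2) ω ∂P
        ≤ ∫ ω in s, (B N n).indicator (fun ω => a (n + 1) * ‖z (n + 1) ω - m‖ ^ 2) ω ∂P := by
          refine integral_mono
            ((hint (n + 1)).indicator (ℱ.le (n + 1) _ (hBmeas N (n + 1)))).integrableOn
            ((hint (n + 1)).indicator (ℱ.le n _ (hBmeas N n))).integrableOn fun ω => ?_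
          exact Set.indicator_le_indicator_of_subset (hBanti N n) (hnn (n + 1)) ω
      _ = a (n + 1) * ∫ ω in s ∩ B N n, ‖z (n + 1) ω - m‖ ^ 2 ∂P := by
          rw [setIntegral_indicator (ℱ.le n _ (hBmeas N n)), integral_const_mul]
      _ ≤ a (n + 1) * ∫ ω in s ∩ B N n,
            ((1 - 2 * c * γ n) * ‖z n ω - m‖ ^ 2 + γ n ^ 2) ∂P := by
          have := ha0 (n + 1)
          gcongr
      _ = ∫ ω in s ∩ B N n, (a (n + 1) * (1 - 2 * c * γ n) * ‖z n ω - m‖ ^ 2 +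
            a (n + 1) * γ n ^ 2) ∂P := by
          rw [← integral_const_mul]
          simp only [mul_add, mul_assoc]
      _ ≤ ∫ ω in s ∩ B N n, ((1 - c * γ n) * (a n * ‖z n ω - m‖ ^ 2) +
            R * (b (n + 1))⁻¹) ∂P := by
          refine integral_mono
            (((h.integrable_norm_sub_sq m n).const_mul _).add (integrable_const _)).integrableOn
            (((hint n).const_mul _).add (integrable_const _)).integrableOn fun ω => ?_
          simp only [← mul_assoc]
          gcongr
      _ = ∫ ω in s, (B N n).indicator (fun ω => (1 - c * γ n) * (a n * ‖z n ω - m‖ ^ 2) +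
            R * (b (n + 1))⁻¹) ω ∂P := (setIntegral_indicator (ℱ.le n _ (hBmeas N n))).symm
      _ ≤ _ := by
          refine integral_mono ((((hint n).const_mul _).add
            (integrable_const _)).indicator (ℱ.le n _ (hBmeas N n))).integrableOn
            ((((hint n).indicator (ℱ.le n _ (hBmeas N n))).const_mul _).add
            (integrable_const _)).integrableOn fun ω => ?_
          by_cases hω : ω ∈ B N n
          · simp [hω]
          · have := hb (n + 1)
            simp only [hω, not_false_eq_true, Set.indicator_of_notMem, mul_zero, zero_add]
            positivity
  choose c hc hcae using hloc
  filter_upwards [h.ae_bdd_norm_sub_sq hγ hγ2 hmono, ae_all_iff.2 hcae] with ω ⟨K, hK⟩ hω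
  -- Each path is bounded, so for a suitable `N` it is never killed and the indicators disappear.
  obtain ⟨N, hN⟩ := exists_nat_ge (Real.sqrt K)
  have hmem : ∀ n, ω ∈ B N n := fun n j _ => (Real.le_sqrt_of_sq_le (hK j)).trans hN
  obtain ⟨⟨K', hK'⟩, hs⟩ := hω N
  simp only [hmem, Set.indicator_of_mem] at hK' hs
  refine ⟨⟨K', fun n => ?_⟩, ?_⟩
  · have := hK' n
    simp only [ha] at this
    rwa [inv_mul_eq_div, div_le_iff₀ (mul_pos (pow_pos (hγ n) 2) (hb n))] at this
  · refine (hs.mul_left (c N)⁻¹).congr fun n => ?_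
    have h1 := (hc N).ne'
    have h2 := (hγ n).ne'
    have h3 := (hb n).ne'
    simp only [ha]
    field_simp

/-- Increments are centered given the past and of norm at most `2`, so the squared norm gains at
most `4` in conditional mean. After division by `b n` the errors `4 / b (n + 1)` are summable. -/
theorem ae_norm_gradNoise_sq_le (h : IsMedianSGD P μ ℱ γ x z)
    {b : ℕ → ℝ} (hb : ∀ n, 0 < b n) (hbmono : Monotone b) (hbs : Summable fun n => (b n)⁻¹) :
    ∀ᵐ ω ∂P, ∃ K, ∀ n, ‖gradNoise μ x z n ω‖ ^ 2 ≤ K * b n := by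
  have hm : ∀ n, Measurable (gradNoise μ x z n) := fun n =>
    (h.measurable_gradNoise n).mono (ℱ.le n) le_rfl
  have hz : ∀ n, Measurable (z n) := fun n => (h.measurable n).mono (ℱ.le n) le_rfl
  have hinc : ∀ n ω, ‖medianGrad μ (z n ω) - unitDir (z n ω - x n ω)‖ ≤ 2 := fun n ω =>
    (norm_sub_le _ _).trans (by
      linarith [norm_medianGrad_le (μ := μ) (z n ω), norm_unitDir_le (z n ω - x n ω)])
  have hbound : ∀ n ω, ‖gradNoise μ x z n ω‖ ≤ 2 * n := fun n ω =>
    (norm_sum_le _ _).trans ((Finset.sum_le_sum fun i _ => hinc i ω).trans (by simp [mul_comm]))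
  have hMi : ∀ n, Integrable (gradNoise μ x z n) P := fun n =>
    Integrable.of_bound (hm n).aestronglyMeasurable (2 * n) (ae_of_all _ (hbound n))
  have hM2 : ∀ n, Integrable (fun ω => ‖gradNoise μ x z n ω‖ ^ 2) P := fun n =>
    Integrable.of_bound ((hm n).norm.pow_const 2).aestronglyMeasurable ((2 * n) ^ 2)
      (ae_of_all _ fun ω => by
        rw [Real.norm_of_nonneg (by positivity)]
        exact pow_le_pow_left₀ (norm_nonneg _) (hbound n ω) 2)
  have hstep : ∀ n s, MeasurableSet[ℱ n] s → ∫ ω in s, ‖gradNoise μ x z (n + 1) ω‖ ^ 2 ∂P ≤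
      ∫ ω in s, (‖gradNoise μ x z n ω‖ ^ 2 + 4) ∂P := by
    intro n s hs
    have hi : ∀ u : Ω → H, Measurable u → (∀ ω, ‖u ω‖ ≤ 1) →
        Integrable (fun ω => (inner ℝ (gradNoise μ x z n ω) (u ω) : ℝ)) P := by
      intro u hu hu1
      refine (hMi n).norm.mono' ((hm n).inner hu).aestronglyMeasurable (ae_of_all _ fun ω => ?_)
      rw [Real.norm_eq_abs]
      exact (abs_real_inner_le_norm _ _).trans (mul_le_of_le_one_right (norm_nonneg _) (hu1 ω))
    have hi1 := hi (fun ω => unitDir (z n ω - x n ω))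
      (measurable_unitDir.comp ((hz n).sub (h.measurable_sample n))) fun ω => norm_unitDir_le _
    have hi2 := hi (fun ω => medianGrad μ (z n ω)) (measurable_medianGrad.comp (hz n))
      fun ω => norm_medianGrad_le _
    have h4 : Integrable (fun ω => ‖gradNoise μ x z n ω‖ ^ 2 + 4) P :=
      (hM2 n).add (integrable_const _)
    have h5 : Integrable (fun ω => 2 * ((inner ℝ (gradNoise μ x z n ω) (medianGrad μ (z n ω)) : ℝ) -
        inner ℝ (gradNoise μ x z n ω) (unitDir (z n ω - x n ω)))) P := (hi2.sub hi1).const_mul 2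
    calc ∫ ω in s, ‖gradNoise μ x z (n + 1) ω‖ ^ 2 ∂P
        ≤ ∫ ω in s, ((‖gradNoise μ x z n ω‖ ^ 2 + 4) +
          2 * ((inner ℝ (gradNoise μ x z n ω) (medianGrad μ (z n ω)) : ℝ) -
            inner ℝ (gradNoise μ x z n ω) (unitDir (z n ω - x n ω)))) ∂P := by
          refine integral_mono (hM2 (n + 1)).integrableOn (h4.add h5).integrableOn fun ω => ?_
          simp only
          rw [show gradNoise μ x z (n + 1) ω = gradNoise μ x z n ω +
            (medianGrad μ (z n ω) - unitDir (z n ω - x n ω)) from Finset.sum_range_succ _ _,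
            norm_add_sq_real, inner_sub_right]
          nlinarith [hinc n ω, norm_nonneg (medianGrad μ (z n ω) - unitDir (z n ω - x n ω))]
      _ = _ := by
          rw [integral_add h4.integrableOn h5.integrableOn, integral_const_mul,
            integral_sub hi2.integrableOn hi1.integrableOn,
            h.setIntegral_inner_unitDir (h.measurable_gradNoise n) (hMi n) hs]
          ring
  have key := ae_bdd_and_summable_of_setIntegral_succ_le (P := P) (ℱ := ℱ)
    (A := fun n ω => (b n)⁻¹ * ‖gradNoise μ x z n ω‖ ^ 2) (p := 0)
    (ν := fun n => 4 * (b (n + 1))⁻¹) (fun n => ?_) (fun n => (hM2 n).const_mul _)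
    (fun n ω => by have := hb n; positivity) (fun n => le_rfl)
    (fun n => by have := hb (n + 1); positivity)
    (((summable_nat_add_iff 1).2 hbs).mul_left 4) (fun n s hs => ?_)
  · filter_upwards [key] with ω ⟨⟨K, hK⟩, _⟩
    refine ⟨K, fun n => ?_⟩
    have := hK n
    rwa [inv_mul_eq_div, div_le_iff₀ (hb n)] at this
  · have h1 : Measurable[ℱ n] fun ω => ‖gradNoise μ x z n ω‖ := 
      measurable_norm.comp (h.measurable_gradNoise n)
    exact ((h1.pow_const 2).const_mul _).stronglyMeasurable
  · have hb1 := hb (n + 1)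
    have hb0 := hb n
    rw [integral_const_mul]
    calc (b (n + 1))⁻¹ * ∫ ω in s, ‖gradNoise μ x z (n + 1) ω‖ ^ 2 ∂P
        ≤ (b (n + 1))⁻¹ * ∫ ω in s, (‖gradNoise μ x z n ω‖ ^ 2 + 4) ∂P := by
          exact mul_le_mul_of_nonneg_left (hstep n s hs) (by positivity)
      _ = ∫ ω in s, (b (n + 1))⁻¹ * (‖gradNoise μ x z n ω‖ ^ 2 + 4) ∂P :=
          (integral_const_mul _ _).symm
      _ ≤ _ := by
          refine integral_mono (((hM2 n).add (integrable_const _)).const_mul _).integrableOn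
            ((((hM2 n).const_mul _).const_mul _).add (integrable_const _)).integrableOn fun ω => ?_
          have h2 : (b (n + 1))⁻¹ ≤ (b n)⁻¹ := inv_anti₀ hb0 (hbmono n.le_succ)
          have h3 := mul_le_mul_of_nonneg_right h2 (sq_nonneg ‖gradNoise μ x z n ω‖)
          simp only [Pi.zero_apply]
          linarith

end IsMedianSGD

end StochasticGradient

/-! ### Deterministic bound for the sum of the errors -/

section AveragedSum

variable {H : Type*} [NormedAddCommGroup H] [InnerProductSpace ℝ H]

/-- Bound for the sum of the errors `V k` of a recursion `V (k + 1) = V k - γ k • D k` whose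
directions `D k` are, up to a noise and a quadratic error, a coercive linear function of `V k`. -/
theorem exists_norm_sum_le {Γ : H → H} {V g D : ℕ → H} {γ b : ℕ → ℝ} {c C K₁ K₂ K₃ K₄ : ℝ}
    (hΓsum : ∀ n, Γ (∑ k ∈ Finset.range n, V k) = ∑ k ∈ Finset.range n, Γ (V k))
    (hc : 0 < c) (hΓ : ∀ k, c * ‖k‖ ^ 2 ≤ inner ℝ (Γ k) k)
    (hγ : ∀ n, 0 < γ n) (hγanti : Antitone γ) (hb : ∀ n, 0 < b n) (hbmono : Monotone b)
    (hV : ∀ k, V (k + 1) = V k - γ k • D k) (hC : 0 ≤ C)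
    (hg : ∀ k, ‖g k - Γ (V k)‖ ≤ C * ‖V k‖ ^ 2)
    (hM : ∀ n, ‖∑ k ∈ Finset.range n, (g k - D k)‖ ^ 2 ≤ K₁ * b n)
    (hV2 : ∀ n, ‖V n‖ ^ 2 ≤ K₂ * (γ n ^ 2 * b n))
    (hVs : Summable fun n => ‖V n‖ ^ 2 / (γ n * b n))
    (hγb : ∀ n, γ n * b n ≤ K₃ * √(b n))
    (hab : ∀ n, ∑ k ∈ Finset.range n, √(b (k + 1)) * (1 - γ (k + 1) / γ k) ≤ K₄ * √(b n)) :
    ∃ K, ∀ n, ‖∑ k ∈ Finset.range n, V k‖ ≤ K * √(b n) := by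
  have hb' : ∀ n, 0 < √(b n) := fun n => Real.sqrt_pos.2 (hb n)
  have hVn : ∀ n, ‖V n‖ ≤ √K₂ * (γ n * √(b n)) := by
    intro n
    have h1 : 0 < γ n ^ 2 * b n := mul_pos (pow_pos (hγ n) 2) (hb n)
    have hK2 : 0 ≤ K₂ := nonneg_of_mul_nonneg_left ((sq_nonneg _).trans (hV2 n)) h1
    refine (Real.le_sqrt_of_sq_le (hV2 n)).trans_eq ?_
    rw [Real.sqrt_mul hK2, Real.sqrt_mul (sq_nonneg _), Real.sqrt_sq (hγ n).le]
  -- Abel summation of `D k = (γ k)⁻¹ • (V k - V (k + 1))`.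
  have hDsum : ∀ n, ∑ k ∈ Finset.range n, D k = (γ 0)⁻¹ • V 0 - (γ n)⁻¹ • V n +
      ∑ k ∈ Finset.range n, ((γ (k + 1))⁻¹ - (γ k)⁻¹) • V (k + 1) := by
    intro n
    induction n with
    | zero => simp
    | succ n ih =>
      rw [Finset.sum_range_succ, Finset.sum_range_succ, ih]
      have h1 : D n = (γ n)⁻¹ • V n - (γ n)⁻¹ • V (n + 1) := by
        rw [hV n, smul_sub, smul_smul, inv_mul_cancel₀ (hγ n).ne', one_smul, sub_sub_cancel]
      rw [h1, sub_smul]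
      abel
  have hD : ∀ n, ‖∑ k ∈ Finset.range n, D k‖ ≤
      (γ 0)⁻¹ * ‖V 0‖ + √K₂ * √(b n) + √K₂ * (K₄ * √(b n)) := by
    intro n
    rw [hDsum]
    refine (norm_add_le _ _).trans (add_le_add ((norm_sub_le _ _).trans (add_le_add ?_ ?_)) ?_)
    · rw [norm_smul, Real.norm_of_nonneg (inv_pos.2 (hγ 0)).le]
    · rw [norm_smul, Real.norm_of_nonneg (inv_pos.2 (hγ n)).le, inv_mul_eq_div,
        div_le_iff₀ (hγ n)]
      linarith [hVn n]
    · refine (norm_sum_le _ _).trans (le_trans ?_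
        (mul_le_mul_of_nonneg_left (hab n) (Real.sqrt_nonneg _)))
      rw [Finset.mul_sum]
      refine Finset.sum_le_sum fun k _ => ?_
      have h1 : 0 ≤ (γ (k + 1))⁻¹ - (γ k)⁻¹ :=
        sub_nonneg.2 (inv_anti₀ (hγ (k + 1)) (hγanti k.le_succ))
      rw [norm_smul, Real.norm_of_nonneg h1]
      calc _ ≤ ((γ (k + 1))⁻¹ - (γ k)⁻¹) * (√K₂ * (γ (k + 1) * √(b (k + 1)))) := by
            gcongr
            exact hVn (k + 1)
        _ = _ := by
            have h2 := (hγ k).ne'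
            have h3 := (hγ (k + 1)).ne'
            field_simp
  set T := ∑' n, ‖V n‖ ^ 2 / (γ n * b n)
  -- Write `‖V k‖²` as `γ k * b k` times the term of a convergent series; the prefactor is at most
  -- `K₃ * √(b n)` for `k < n`.
  have hrem : ∀ n, ‖∑ k ∈ Finset.range n, (g k - Γ (V k))‖ ≤ C * (K₃ * √(b n) * T) := by
    intro n
    have hK3 : 0 ≤ K₃ :=
      nonneg_of_mul_nonneg_left ((mul_pos (hγ 0) (hb 0)).le.trans (hγb 0)) (hb' 0)
    have hnn : ∀ k, 0 ≤ ‖V k‖ ^ 2 / (γ k * b k) := fun k =>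
      div_nonneg (sq_nonneg _) (mul_pos (hγ k) (hb k)).le
    calc _ ≤ ∑ k ∈ Finset.range n, C * (K₃ * √(b n) * (‖V k‖ ^ 2 / (γ k * b k))) := by
          refine norm_sum_le_of_le _ fun k hk => (hg k).trans ?_
          have h1 : ‖V k‖ ^ 2 = γ k * b k * (‖V k‖ ^ 2 / (γ k * b k)) :=
            (mul_div_cancel₀ _ (mul_pos (hγ k) (hb k)).ne').symm
          have h2 : γ k * b k ≤ K₃ * √(b n) := (hγb k).trans (by
            have := hbmono (Finset.mem_range.1 hk).le
            gcongr)
          have h3 := hnn k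
          calc C * ‖V k‖ ^ 2 = C * (γ k * b k * (‖V k‖ ^ 2 / (γ k * b k))) := by rw [← h1]
            _ ≤ _ := by gcongr
      _ = C * (K₃ * √(b n) * ∑ k ∈ Finset.range n, ‖V k‖ ^ 2 / (γ k * b k)) := by
          rw [Finset.mul_sum, Finset.mul_sum]
      _ ≤ _ := by
          have := hb' n
          gcongr
          exact hVs.sum_le_tsum _ fun k _ => hnn k
  have hMn : ∀ n, ‖∑ k ∈ Finset.range n, (g k - D k)‖ ≤ √K₁ * √(b n) := by
    intro n
    rw [← Real.sqrt_mul' _ (hb n).le]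
    exact Real.le_sqrt_of_sq_le (hM n)
  have hcoer : ∀ k, c * ‖k‖ ≤ ‖Γ k‖ := by
    intro k
    rcases eq_or_ne k 0 with rfl | hk
    · simp
    · have h1 := (hΓ k).trans (real_inner_le_norm _ _)
      rw [sq, ← mul_assoc] at h1
      exact le_of_mul_le_mul_right h1 (norm_pos_iff.2 hk)
  refine ⟨c⁻¹ * (√K₁ + ((γ 0)⁻¹ * ‖V 0‖ / √(b 0) + √K₂ + √K₂ * K₄) + C * (K₃ * T)), fun n => ?_⟩
  have hid : Γ (∑ k ∈ Finset.range n, V k) = ∑ k ∈ Finset.range n, (g k - D k) +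
      ∑ k ∈ Finset.range n, D k - ∑ k ∈ Finset.range n, (g k - Γ (V k)) := by
    rw [hΓsum, ← Finset.sum_add_distrib, ← Finset.sum_sub_distrib]
    exact Finset.sum_congr rfl fun k _ => by abel
  have h0 : (γ 0)⁻¹ * ‖V 0‖ ≤ (γ 0)⁻¹ * ‖V 0‖ / √(b 0) * √(b n) := by
    have h1 : √(b 0) ≤ √(b n) := Real.sqrt_le_sqrt (hbmono n.zero_le)
    have h2 := hγ 0
    calc (γ 0)⁻¹ * ‖V 0‖ = (γ 0)⁻¹ * ‖V 0‖ / √(b 0) * √(b 0) :=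
          (div_mul_cancel₀ _ (hb' 0).ne').symm
      _ ≤ _ := by gcongr
  have hΓn : ‖Γ (∑ k ∈ Finset.range n, V k)‖ ≤ √K₁ * √(b n) +
      ((γ 0)⁻¹ * ‖V 0‖ + √K₂ * √(b n) + √K₂ * (K₄ * √(b n))) + C * (K₃ * √(b n) * T) := by
    rw [hid]
    exact (norm_sub_le _ _).trans
      (add_le_add ((norm_add_le _ _).trans (add_le_add (hMn n) (hD n))) (hrem n))
  rw [mul_assoc, inv_mul_eq_div, le_div_iff₀ hc, mul_comm]
  refine (hcoer _).trans (hΓn.trans ?_)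
  linarith

end AveragedSum

/-! ### Estimates for the steps and the logarithmic weight -/

section StepSize

/-- The weight `(n + 2) log (n + 2) ^ s`. -/
noncomputable def logWeight (s : ℝ) (n : ℕ) : ℝ := (n + 2 : ℝ) * Real.log (n + 2) ^ s

theorem log_add_two_pos (n : ℕ) : 0 < Real.log (n + 2 : ℝ) :=
  Real.log_pos (by have : (0 : ℝ) ≤ n := n.cast_nonneg; linarith)

theorem logWeight_pos (s : ℝ) (n : ℕ) : 0 < logWeight s n :=
  mul_pos (by positivity) (Real.rpow_pos_of_pos (log_add_two_pos n) s)

theorem monotone_logWeight {s : ℝ} (hs : 0 ≤ s) : Monotone (logWeight s) := by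
  intro i j hij
  have h1 : (i : ℝ) ≤ j := by exact_mod_cast hij
  have h2 := (log_add_two_pos i).le
  unfold logWeight
  gcongr

/-- Cauchy condensation reduces the series to `∑ k ^ (-s)`. -/
theorem summable_inv_logWeight {s : ℝ} (hs : 1 < s) : Summable fun n => (logWeight s n)⁻¹ := by
  set f : ℕ → ℝ := fun n => ((n : ℝ) * Real.log n ^ s)⁻¹ with hf
  have h1 : ∀ n, (logWeight s n)⁻¹ = f (n + 2) := by
    intro n
    simp only [logWeight, hf]
    push_cast
    rfl
  simp only [h1]
  rw [summable_nat_add_iff 2, ← summable_condensed_iff_of_eventually_nonneg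
    (Eventually.of_forall fun n => inv_nonneg.2
      (mul_nonneg n.cast_nonneg (Real.rpow_nonneg (Real.log_natCast_nonneg n) s)))]
  · refine ((Real.summable_nat_rpow_inv.2 hs).mul_left (Real.log 2 ^ s)⁻¹).congr fun k => ?_
    have hlog : Real.log ((2 ^ k : ℕ) : ℝ) = k * Real.log 2 := by
      push_cast
      exact Real.log_pow 2 k
    rw [hlog, Real.mul_rpow k.cast_nonneg (Real.log_nonneg (by norm_num))]
    push_cast
    rw [mul_inv, mul_inv_cancel_left₀ (by positivity), mul_inv, mul_comm]
  · filter_upwards [eventually_ge_atTop 2] with n hn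
    have hn2 : (2 : ℝ) ≤ n := by exact_mod_cast hn
    have hlog : 0 < Real.log n := Real.log_pos (by linarith)
    push_cast
    gcongr
    · linarith
    · linarith

theorem sqrt_logWeight (s : ℝ) (n : ℕ) :
    √(logWeight s n) = √(n + 2) * Real.log (n + 2) ^ (s / 2) := by
  rw [logWeight, Real.sqrt_mul (by positivity), Real.sqrt_eq_rpow (Real.log _ ^ s),
    ← Real.rpow_mul (log_add_two_pos n).le]
  congr 2
  ring

variable {c α : ℝ}

theorem stepSize_succ_pos (hc : 0 < c) (n : ℕ) : 0 < stepSize c α (n + 1) :=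
  mul_pos hc (Real.rpow_pos_of_pos (by positivity) _)

theorem antitone_stepSize_succ (hc : 0 < c) (hα : 0 ≤ α) :
    Antitone fun n => stepSize c α (n + 1) := by
  intro i j hij
  have h1 : (i : ℝ) ≤ j := by exact_mod_cast hij
  simp only [stepSize]
  push_cast
  exact mul_le_mul_of_nonneg_left
    (Real.rpow_le_rpow_of_nonpos (by positivity) (by linarith) (by linarith)) hc.le

theorem summable_stepSize_sq (hα : 1 / 2 < α) : Summable fun n => stepSize c α (n + 1) ^ 2 := by
  have h : Summable fun n : ℕ => c ^ 2 * (n : ℝ) ^ (-(2 * α)) :=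
    (Real.summable_nat_rpow.2 (by linarith)).mul_left _
  refine ((summable_nat_add_iff 1).2 h).congr fun n => ?_
  rw [stepSize, mul_pow, ← Real.rpow_natCast (_ ^ (-α)), ← Real.rpow_mul (by positivity)]
  congr 2
  push_cast
  ring

/-- Consecutive steps have ratio at least `1 - 1 / (n + 2)`. -/
theorem div_le_stepSize_succ_div (hc : 0 < c) (hα' : α ≤ 1) (n : ℕ) :
    ((n : ℝ) + 1) / (n + 2) ≤ stepSize c α (n + 2) / stepSize c α (n + 1) := by
  have h1 : stepSize c α (n + 2) / stepSize c α (n + 1) = (((n : ℝ) + 1) / (n + 2)) ^ α := by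
    simp only [stepSize]
    push_cast
    rw [mul_div_mul_left _ _ hc.ne', Real.div_rpow (by positivity) (by positivity),
      Real.rpow_neg (by positivity), Real.rpow_neg (by positivity), inv_div_inv]
  rw [h1]
  refine Real.self_le_rpow_of_le_one (by positivity) ?_ hα'
  rw [div_le_one (by positivity)]
  linarith

theorem stepSize_sq_le (hc : 0 < c) (hα' : α ≤ 1) (n : ℕ) :
    stepSize c α (n + 1) ^ 2 ≤ (1 + 1 / ((n : ℝ) + 1)) ^ 2 * stepSize c α (n + 2) ^ 2 := by
  rw [← mul_pow]
  have h1 := div_le_stepSize_succ_div hc hα' n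
  have h2 := stepSize_succ_pos (α := α) hc n
  rw [le_div_iff₀ h2] at h1
  have h3 : stepSize c α (n + 1) =
      (1 + 1 / ((n : ℝ) + 1)) * (((n : ℝ) + 1) / (n + 2) * stepSize c α (n + 1)) := by
    field_simp
    ring
  refine pow_le_pow_left₀ h2.le ?_ 2
  rw [h3]
  gcongr

/-- As `α < 1`, `n γ_n → ∞`: the relative decrease of the squared steps, at most `3 / (n + 1)`, is
eventually below `d γ_n`. -/
theorem eventually_stepSize_contraction (hc : 0 < c) (hα : 0 < α) (hα' : α < 1) {d : ℝ}
    (hd : 0 < d) :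
    ∀ᶠ n in atTop, 0 ≤ 1 - 2 * d * stepSize c α (n + 1) ∧
      stepSize c α (n + 1) ^ 2 * (1 - 2 * d * stepSize c α (n + 1)) ≤
        stepSize c α (n + 1 + 1) ^ 2 * (1 - d * stepSize c α (n + 1)) := by
  have hcast : Tendsto (fun n : ℕ => ((n + 1 : ℕ) : ℝ)) atTop atTop :=
    tendsto_natCast_atTop_atTop.comp (tendsto_add_atTop_nat 1)
  have h1 : Tendsto (fun n : ℕ => stepSize c α (n + 1)) atTop (𝓝 0) := by
    have := ((tendsto_rpow_neg_atTop hα).comp hcast).const_mul c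
    rwa [mul_zero] at this
  have h2 : Tendsto (fun n : ℕ => ((n + 1 : ℕ) : ℝ) ^ (1 - α)) atTop atTop :=
    (tendsto_rpow_atTop (by linarith)).comp hcast
  filter_upwards [h1.eventually_le_const (show 0 < 1 / (2 * d) by positivity),
    h2.eventually_ge_atTop (3 / (d * c))] with n e1 e2
  set γ := stepSize c α (n + 1) with hγ
  have hγ0 : 0 < γ := stepSize_succ_pos hc n
  have e3 : 0 ≤ 1 - 2 * d * γ := by
    rw [le_div_iff₀ (by positivity)] at e1
    linarith
  refine ⟨e3, ?_⟩
  have e4 := stepSize_sq_le hc hα'.le n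
  set t : ℝ := 1 / ((n : ℝ) + 1) with ht
  have ht0 : 0 < t := by positivity
  have ht1 : t ≤ 1 := by
    rw [ht, div_le_one (by positivity)]
    linarith [n.cast_nonneg (α := ℝ)]
  have e5 : 3 * t ≤ d * γ := by
    have hn : (0 : ℝ) < ((n + 1 : ℕ) : ℝ) := by positivity
    have e6 : γ = c * (((n + 1 : ℕ) : ℝ) ^ (1 - α) * t) := by
      rw [hγ, stepSize, Real.rpow_sub hn, Real.rpow_one, Real.rpow_neg hn.le, ht]
      push_cast
      field_simp
    rw [div_le_iff₀ (by positivity)] at e2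
    rw [e6]
    nlinarith
  have e7 : (1 + t) ^ 2 * (1 - 2 * d * γ) ≤ 1 - d * γ := by
    have e8 : (1 + t) ^ 2 ≤ 1 + 3 * t := by nlinarith
    calc _ ≤ (1 + 3 * t) * (1 - 2 * d * γ) := by gcongr
      _ ≤ _ := by nlinarith [mul_pos ht0 (mul_pos hd hγ0)]
  calc _ ≤ (1 + t) ^ 2 * stepSize c α (n + 2) ^ 2 * (1 - 2 * d * γ) := by gcongr
    _ = stepSize c α (n + 2) ^ 2 * ((1 + t) ^ 2 * (1 - 2 * d * γ)) := by ring
    _ ≤ _ := by gcongr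

/-- Equivalent to boundedness of `γ_n √(b_n)`: the factor `n ^ (1/2 - α)` beats any power of the
logarithm. -/
theorem exists_stepSize_mul_logWeight_le (hc : 0 < c) (hα : 1 / 2 < α) {s : ℝ} (hs : 0 < s) :
    ∃ K, ∀ n, stepSize c α (n + 1) * logWeight s n ≤ K * √(logWeight s n) := by
  -- Chosen so that `log x ≤ x ^ η / η`, raised to the power `s / 2`, gives exactly `x ^ (α - 1/2)`.
  set η := (α - 1 / 2) * (2 / s) with hη
  have hη0 : 0 < η := mul_pos (by linarith) (by positivity)
  refine ⟨c * (2 ^ α * (1 / η) ^ (s / 2)), fun n => ?_⟩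
  have hw := logWeight_pos s n
  nth_rw 1 [← Real.mul_self_sqrt hw.le]
  rw [← mul_assoc]
  refine mul_le_mul_of_nonneg_right ?_ (Real.sqrt_nonneg _)
  rw [sqrt_logWeight, stepSize, mul_assoc]
  refine mul_le_mul_of_nonneg_left ?_ hc.le
  have hn : (0 : ℝ) < n + 2 := by positivity
  have h1 : (((n + 1 : ℕ) : ℝ)) ^ (-α) ≤ 2 ^ α * (n + 2 : ℝ) ^ (-α) := by
    rw [Real.rpow_neg hn.le, ← div_eq_mul_inv, ← Real.div_rpow (by norm_num) hn.le,
      ← inv_div, Real.inv_rpow (by positivity), ← Real.rpow_neg (by positivity)]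
    refine Real.rpow_le_rpow_of_nonpos (by positivity) ?_ (by linarith)
    push_cast
    linarith [n.cast_nonneg (α := ℝ)]
  have h2 : Real.log (n + 2) ^ (s / 2) ≤ (1 / η) ^ (s / 2) * (n + 2 : ℝ) ^ (α - 1 / 2) := by
    have h3 := Real.log_le_rpow_div hn.le hη0
    calc _ ≤ ((n + 2 : ℝ) ^ η / η) ^ (s / 2) := by
          have := (log_add_two_pos n).le
          gcongr
      _ = _ := by
          rw [div_eq_inv_mul, Real.mul_rpow (by positivity) (by positivity), ← Real.rpow_mul hn.le,
            one_div]
          congr 2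
          rw [hη]
          field_simp
  have hlog := Real.rpow_nonneg (log_add_two_pos n).le (s / 2)
  calc _ ≤ 2 ^ α * (n + 2 : ℝ) ^ (-α) *
        (√(n + 2) * ((1 / η) ^ (s / 2) * (n + 2 : ℝ) ^ (α - 1 / 2))) := by gcongr
    _ = 2 ^ α * (1 / η) ^ (s / 2) *
        ((n + 2 : ℝ) ^ (-α) * (n + 2 : ℝ) ^ (1 / 2 : ℝ) * (n + 2 : ℝ) ^ (α - 1 / 2)) := by
        rw [Real.sqrt_eq_rpow]; ring
    _ = _ := by
        rw [← Real.rpow_add hn, ← Real.rpow_add hn,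
          show -α + 1 / 2 + (α - 1 / 2) = 0 by ring, Real.rpow_zero, mul_one]

/-- The ratio defect is at most `1 / (k + 2)`, so up to the logarithm, bounded by its last value,
the terms are dominated by a telescoping sum of square roots. -/
theorem sum_sqrt_logWeight_le (hc : 0 < c) (hα : 0 ≤ α) (hα' : α ≤ 1) {s : ℝ} (hs : 0 ≤ s)
    (n : ℕ) :
    ∑ k ∈ Finset.range n, √(logWeight s (k + 1)) *
      (1 - stepSize c α (k + 1 + 1) / stepSize c α (k + 1)) ≤ 4 * √(logWeight s n) := by
  have h1 : ∀ k : ℕ, √((k : ℝ) + 3) * (1 / (k + 2)) ≤ 4 * (√((k : ℝ) + 3) - √((k : ℝ) + 2)) := by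
    intro k
    have e1 : (√((k : ℝ) + 3)) ^ 2 = k + 3 := Real.sq_sqrt (by positivity)
    have e2 : (√((k : ℝ) + 2)) ^ 2 = k + 2 := Real.sq_sqrt (by positivity)
    have e3 : 0 < √((k : ℝ) + 2) := Real.sqrt_pos.2 (by positivity)
    have e4 : √((k : ℝ) + 2) ≤ √((k : ℝ) + 3) := Real.sqrt_le_sqrt (by linarith)
    set p := √((k : ℝ) + 3)
    set q := √((k : ℝ) + 2)
    have e5 : (p - q) * (p + q) = 1 := by nlinarith
    have e6 : p * (p + q) ≤ 4 * (k + 2) := by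
      have : (0 : ℝ) ≤ k := k.cast_nonneg
      nlinarith
    rw [mul_one_div, div_le_iff₀ (by positivity)]
    have e7 : p = (p - q) * (p * (p + q)) := by
      calc p = p * ((p - q) * (p + q)) := by rw [e5, mul_one]
        _ = _ := by ring
    rw [e7]
    nlinarith [mul_le_mul_of_nonneg_left e6 (sub_nonneg.2 e4)]
  have hlogn := Real.rpow_nonneg (log_add_two_pos n).le (s / 2)
  calc _ ≤ ∑ k ∈ Finset.range n, Real.log (n + 2) ^ (s / 2) *
        (4 * (√(((k + 1 : ℕ) : ℝ) + 2) - √((k : ℝ) + 2))) := by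
        refine Finset.sum_le_sum fun k hk => ?_
        have e0 : ((k + 1 : ℕ) : ℝ) + 2 = k + 3 := by push_cast; ring
        have e1 := div_le_stepSize_succ_div (c := c) hc hα' k
        have e2 : 1 - stepSize c α (k + 1 + 1) / stepSize c α (k + 1) ≤ 1 / ((k : ℝ) + 2) := by
          have : ((k : ℝ) + 1) / (k + 2) = 1 - 1 / (k + 2) := by field_simp; ring
          linarith
        have e3 : Real.log (((k + 1 : ℕ) : ℝ) + 2) ^ (s / 2) ≤ Real.log (n + 2) ^ (s / 2) := by
          have e4 : ((k + 1 : ℕ) : ℝ) ≤ n := by exact_mod_cast Finset.mem_range.1 hk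
          have := (log_add_two_pos (k + 1)).le
          gcongr
        rw [sqrt_logWeight]
        calc _ ≤ √(((k + 1 : ℕ) : ℝ) + 2) * Real.log (n + 2) ^ (s / 2) * (1 / ((k : ℝ) + 2)) := by
              have e5 : 0 ≤ 1 - stepSize c α (k + 1 + 1) / stepSize c α (k + 1) :=
                sub_nonneg.2 ((div_le_one (stepSize_succ_pos hc k)).2
                  (antitone_stepSize_succ hc hα k.le_succ))
              gcongr
          _ = Real.log (n + 2) ^ (s / 2) * (√(((k + 1 : ℕ) : ℝ) + 2) * (1 / (k + 2))) := by ring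
          _ ≤ _ := by
              rw [e0]
              exact mul_le_mul_of_nonneg_left (h1 k) hlogn
    _ = Real.log (n + 2) ^ (s / 2) * (4 * (√((n : ℝ) + 2) - √(((0 : ℕ) : ℝ) + 2))) := by
        rw [← Finset.mul_sum, ← Finset.mul_sum,
          Finset.sum_range_sub (fun k : ℕ => √((k : ℝ) + 2))]
    _ ≤ _ := by
        rw [sqrt_logWeight]
        have := Real.sqrt_nonneg (((0 : ℕ) : ℝ) + 2)
        nlinarith [mul_nonneg hlogn this]

theorem isLittleO_sqrt_logWeight {s t : ℝ} (hs : 0 ≤ s) (hst : s < t) :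
    (fun n : ℕ => √(logWeight s n) / n) =o[atTop]
      fun n : ℕ => Real.log n ^ (t / 2) / √n := by
  have hO : (fun n : ℕ => √(logWeight s n) / n) =O[atTop]
      fun n : ℕ => Real.log n ^ (s / 2) * (√n)⁻¹ := by
    refine IsBigO.of_bound (2 * 2 ^ (s / 2)) ?_
    filter_upwards [eventually_ge_atTop 2] with n hn
    have hn2 : (2 : ℝ) ≤ n := by exact_mod_cast hn
    have h0 : 0 < √(n : ℝ) := Real.sqrt_pos.2 (by linarith)
    have hlog : 0 < Real.log n := Real.log_pos (by linarith)
    rw [Real.norm_of_nonneg (by positivity), Real.norm_of_nonneg (by positivity), sqrt_logWeight]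
    have h1 : √((n : ℝ) + 2) ≤ 2 * √n := by
      rw [Real.sqrt_le_left (by positivity), mul_pow, Real.sq_sqrt (by linarith)]
      linarith
    have h2 : Real.log (n + 2) ≤ 2 * Real.log n := by
      rw [← Real.log_rpow (by linarith), Real.rpow_two]
      exact Real.log_le_log (by linarith) (by nlinarith)
    have h3 : Real.log (n + 2) ^ (s / 2) ≤ 2 ^ (s / 2) * Real.log n ^ (s / 2) := by
      rw [← Real.mul_rpow (by norm_num) hlog.le]
      have := (log_add_two_pos n).le
      gcongr
    have h4 := Real.rpow_nonneg (log_add_two_pos n).le (s / 2)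
    have h5 : 2 * √n / n = 2 * (√(n : ℝ))⁻¹ := by
      rw [mul_div_assoc, Real.sqrt_div_self]
    calc _ ≤ 2 * √n * (2 ^ (s / 2) * Real.log n ^ (s / 2)) / n := by gcongr
      _ = 2 * √n / n * (2 ^ (s / 2) * Real.log n ^ (s / 2)) := by ring
      _ = _ := by rw [h5]; ring
  have ho : (fun n : ℕ => Real.log n ^ (s / 2)) =o[atTop] fun n : ℕ => Real.log n ^ (t / 2) := by
    have h1 : (fun x : ℝ => x ^ (-((t - s) / 2))) =o[atTop] fun _ : ℝ => (1 : ℝ) :=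
      (isLittleO_one_iff ℝ).2 (tendsto_rpow_neg_atTop (by linarith))
    have h : (fun x : ℝ => x ^ (s / 2)) =o[atTop] fun x : ℝ => x ^ (t / 2) := by
      refine ((isBigO_refl (fun x : ℝ => x ^ (t / 2)) atTop).mul_isLittleO h1).congr' ?_ ?_
      · filter_upwards [eventually_gt_atTop 0] with x hx
        rw [← Real.rpow_add hx]
        congr 1
        ring
      · exact Eventually.of_forall fun x => mul_one _
    exact h.comp_tendsto (Real.tendsto_log_atTop.comp tendsto_natCast_atTop_atTop)
  refine (hO.trans_isLittleO (ho.mul_isBigO (isBigO_refl _ _))).congr_right fun n =>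
    (div_eq_mul_inv _ _).symm

end StepSize

/-! ### Filtration, consequences of the assumptions, conclusion -/

section Assembly

/-- The filtration generated by an initial variable and a sequence of independent samples. -/
theorem exists_filtration_of_iIndepFun {Ω H : Type*} {mΩ : MeasurableSpace Ω} {P : Measure Ω}
    [IsProbabilityMeasure P] [MeasurableSpace H] [Zero H] {Z : Ω → H} {x : ℕ → Ω → H}
    (hZ : Measurable Z) (hx : ∀ n, Measurable (x n)) (hindep : iIndepFun x P)
    (hZx : IndepFun Z (fun ω n => x n ω) P) :
    ∃ ℱ : Filtration ℕ mΩ, Measurable[ℱ 0] Z ∧ (∀ n, Measurable[ℱ (n + 1)] (x n)) ∧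
      ∀ n, Indep (ℱ n) (MeasurableSpace.comap (x n) inferInstance) P := by
  -- Padding by `0` presents the past at time `n`, the initial variable and the first `n` samples,
  -- as one map into a fixed space.
  set trunc : ℕ → (ℕ → H) → (ℕ → H) := fun n v k => if k < n then v k else 0 with htrunc
  have htm : ∀ n, Measurable (trunc n) := by
    refine fun n => measurable_pi_lambda _ fun k => ?_
    by_cases hk : k < n
    · simpa [htrunc, hk] using measurable_pi_apply k
    · simp [htrunc, hk]
  set seq : Ω → ℕ → H := fun ω n => x n ω with hseq
  have hseqm : Measurable seq := measurable_pi_lambda _ hx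
  set T : ℕ → Ω → H × (ℕ → H) := fun n ω => (Z ω, trunc n (seq ω)) with hT
  have hTm : ∀ n, Measurable (T n) := fun n => hZ.prodMk ((htm n).comp hseqm)
  let ℱ : Filtration ℕ mΩ :=
    { seq := fun n => MeasurableSpace.comap (T n) inferInstance
      mono' := by
        intro i j hij
        have h1 : T i = (fun q => (q.1, trunc i q.2)) ∘ T j := by
          funext ω
          simp only [hT, htrunc, Function.comp_apply, Prod.mk.injEq, true_and]
          funext k
          split_ifs with h1 h2
          · rfl
          · omega
          · rfl
        change MeasurableSpace.comap (T i) _ ≤ MeasurableSpace.comap (T j) _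
        rw [h1, ← MeasurableSpace.comap_comp]
        exact MeasurableSpace.comap_mono
          (measurable_fst.prodMk ((htm i).comp measurable_snd)).comap_le
      le' := fun n => (hTm n).comap_le }
  have hTF : ∀ n, Measurable[ℱ n] (T n) := fun n => comap_measurable (T n)
  refine ⟨ℱ, measurable_fst.comp (hTF 0), fun n => ?_, fun n => ?_⟩
  · have h1 : x n = (fun q : H × (ℕ → H) => q.2 n) ∘ T (n + 1) := by
      funext ω
      simp [hT, htrunc, hseq]
    rw [h1]
    exact ((measurable_pi_apply n).comp measurable_snd).comp (hTF (n + 1))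
  · have hBC : IndepFun (fun ω => trunc n (seq ω)) (x n) P := by
      have h1 := hindep.indepFun_finset (Finset.range n) {n} (by simp) hx
      have h2 : Measurable fun (v : Finset.range n → H) (k : ℕ) =>
          if hk : k ∈ Finset.range n then v ⟨k, hk⟩ else 0 := by
        refine measurable_pi_lambda _ fun k => ?_
        by_cases hk : k ∈ Finset.range n
        · simpa only [hk, dite_true] using measurable_pi_apply _
        · simpa only [hk, dite_false] using measurable_const
      have h3 : Measurable fun v : ({n} : Finset ℕ) → H => v ⟨n, Finset.mem_singleton_self n⟩ :=
        measurable_pi_apply _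
      convert h1.comp h2 h3 using 1
      · funext ω k
        simp [htrunc, hseq]
      · rfl
    have hABC : IndepFun Z (fun ω => (trunc n (seq ω), x n ω)) P :=
      hZx.comp measurable_id ((htm n).prodMk (measurable_pi_apply n))
    have hAB : IndepFun Z (fun ω => trunc n (seq ω)) P := hZx.comp measurable_id (htm n)
    have hBm : Measurable fun ω => trunc n (seq ω) := (htm n).comp hseqm
    -- If `Z` is independent of the pair (past samples, new sample) and these two are independent,
    -- then (`Z`, past) is independent of the new sample: on laws, associativity of products.
    have hmain : IndepFun (T n) (x n) P := by
      have := Measure.isProbabilityMeasure_map (μ := P) hZ.aemeasurable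
      have := Measure.isProbabilityMeasure_map (μ := P) hBm.aemeasurable
      have := Measure.isProbabilityMeasure_map (μ := P) (hx n).aemeasurable
      rw [indepFun_iff_map_prod_eq_prod_map_map (hTm n).aemeasurable (hx n).aemeasurable]
      have e1 := hABC.map_prod_eq_prod_map_map hZ.aemeasurable
        (hBm.prodMk (hx n)).aemeasurable
      rw [hBC.map_prod_eq_prod_map_map hBm.aemeasurable (hx n).aemeasurable] at e1
      have e2 := hAB.map_prod_eq_prod_map_map hZ.aemeasurable hBm.aemeasurable
      change _ = (P.map (fun ω => (Z ω, trunc n (seq ω)))).prod _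
      have e3 := congrArg (Measure.map MeasurableEquiv.prodAssoc.symm) (Measure.prodAssoc_prod
        (μ := P.map Z) (ν := P.map fun ω => trunc n (seq ω)) (τ := P.map (x n)))
      rw [Measure.map_map (MeasurableEquiv.measurable _) (MeasurableEquiv.measurable _),
        MeasurableEquiv.symm_comp_self, Measure.map_id, ← e1,
        Measure.map_map (MeasurableEquiv.measurable _) (hZ.prodMk (hBm.prodMk (hx n)))] at e3
      rw [e2, e3]
      rfl
    exact (IndepFun_iff_Indep _ _ _).1 hmain

variable {Ω H : Type*} [NormedAddCommGroup H] [InnerProductSpace ℝ H]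

theorem sgdIterate_add_two (γ : ℕ → ℝ) (X : ℕ → Ω → H) (Z₁ : Ω → H) (n : ℕ) (ω : Ω) :
    sgdIterate γ X Z₁ (n + 2) ω = sgdIterate γ X Z₁ (n + 1) ω -
      γ (n + 1) • unitDir (sgdIterate γ X Z₁ (n + 1) ω - X (n + 2) ω) := by
  rw [sgdIterate, ← neg_sub (X (n + 2) ω), unitDir_neg, smul_neg, sub_neg_eq_add, unitDir]

theorem averagedIterate_sub_eq (Z : ℕ → Ω → H) (m : H) {n : ℕ} (hn : 1 ≤ n) (ω : Ω) :
    averagedIterate Z n ω - m = (n : ℝ)⁻¹ • ∑ k ∈ Finset.range n, (Z (k + 1) ω - m) := by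
  have h0 : (n : ℝ) ≠ 0 := by positivity
  rw [averagedIterate_eq_mean Z n hn, Finset.sum_sub_distrib, smul_sub, Finset.sum_const,
    Finset.card_range, ← Nat.cast_smul_eq_nsmul ℝ, smul_smul, inv_mul_cancel₀ h0, one_smul,
    Finset.range_eq_Ico, Finset.sum_Ico_add' (fun k => Z k ω) 0 n 1]
  rfl

variable [MeasurableSpace Ω] {P : Measure Ω} [MeasurableSpace H] [BorelSpace H]

omit [InnerProductSpace ℝ H] in
theorem ae_sub_ne_zero_of_notConcentratedAroundPoints {X : Ω → H} (hX : Measurable X)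
    [SecondCountableTopology H]
    (hA2 : NotConcentratedAroundPoints P X) (m : H) : ∀ᵐ x ∂(P.map X), m - x ≠ 0 := by
  obtain ⟨C, -, hC⟩ := hA2
  have hmeas : MeasurableSet {x | m - x ≠ 0} :=
    (measurableSet_eq_fun (measurable_const.sub measurable_id) measurable_const).compl
  rw [ae_map_iff hX.aemeasurable hmeas]
  have h1 : ∫⁻ ω, ‖X ω - m‖ₑ⁻¹ ∂P ≠ ∞ := ((hC m).1.trans_lt ENNReal.ofReal_lt_top).ne
  filter_upwards [ae_lt_top (by fun_prop) h1] with ω hω h0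
  rw [← neg_sub, neg_eq_zero] at h0
  simp [h0] at hω

omit [InnerProductSpace ℝ H] in
-- The real inverse of `0` is `0` while the extended one is `∞`; they agree almost everywhere
-- because finite inverse moments exclude an atom at `m`.
theorem integrable_inv_norm_pow_of_notConcentratedAroundPoints [SecondCountableTopology H]
    {X : Ω → H} (hX : Measurable X)
    (hA2 : NotConcentratedAroundPoints P X) (m : H) :
    Integrable (fun x => ‖m - x‖⁻¹) (P.map X) ∧ Integrable (fun x => ‖m - x‖⁻¹ ^ 2) (P.map X) := by
  have h0 := ae_sub_ne_zero_of_notConcentratedAroundPoints hX hA2 m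
  have h0' := ae_of_ae_map hX.aemeasurable h0
  obtain ⟨C, -, hC⟩ := hA2
  obtain ⟨hC1, hC2⟩ := hC m
  have key : ∀ ω, m - X ω ≠ 0 → ‖‖m - X ω‖⁻¹‖ₑ = ‖X ω - m‖ₑ⁻¹ := by
    intro ω hω
    rw [enorm_inv (norm_ne_zero_iff.2 hω), enorm_norm, ← enorm_neg, neg_sub]
  constructor
  · rw [integrable_map_measure (Measurable.aestronglyMeasurable (by fun_prop)) hX.aemeasurable]
    refine ⟨Measurable.aestronglyMeasurable (by fun_prop), lt_of_eq_of_lt ?_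
      (hC1.trans_lt ENNReal.ofReal_lt_top)⟩
    refine lintegral_congr_ae (h0'.mono fun ω hω => ?_)
    exact key ω hω
  · rw [integrable_map_measure (Measurable.aestronglyMeasurable (by fun_prop)) hX.aemeasurable]
    refine ⟨Measurable.aestronglyMeasurable (by fun_prop), lt_of_eq_of_lt ?_
      (hC2.trans_lt ENNReal.ofReal_lt_top)⟩
    refine lintegral_congr_ae (h0'.mono fun ω hω => ?_)
    simp only [Function.comp_apply]
    rw [enorm_pow, key ω hω, ENNReal.inv_pow]

/-- An almost surely constant variable has zero variance. -/
theorem exists_orthogonal_not_ae_const [SecondCountableTopology H] {X : Ω → H} (hX : Measurable X)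
    [IsProbabilityMeasure P] (hA1 : NotConcentratedOnLine P X) (m e : H) :
    ∃ h', inner ℝ e h' = 0 ∧ ¬ ∀ᵐ x ∂(P.map X), inner ℝ x h' = inner ℝ m h' := by
  obtain ⟨h', he, hvar⟩ := hA1 e
  refine ⟨h', he, fun hae => hvar.ne' ?_⟩
  have h1 : ∀ᵐ ω ∂P, inner ℝ (X ω) h' = inner ℝ m h' := ae_of_ae_map hX.aemeasurable hae
  rw [evariance_eq_zero_iff (hX.inner measurable_const).aemeasurable]
  filter_upwards [h1] with ω hω
  rw [hω, integral_congr_ae h1]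
  simp

end Assembly

theorem corollary5p1
    {Ω H : Type*} [MeasurableSpace Ω] {P : Measure Ω} [IsProbabilityMeasure P]
    [NormedAddCommGroup H] [InnerProductSpace ℝ H] [CompleteSpace H]
    [TopologicalSpace.SeparableSpace H] [MeasurableSpace H] [BorelSpace H]
    -- the random variable `X` and its geometric median `m`
    (X : Ω → H) (hX : Measurable X)
    (hA1 : NotConcentratedOnLine P X) (hA2 : NotConcentratedAroundPoints P X)
    (m : H) (hm : IsGeometricMedian P X m)
    -- `Xs 1, Xs 2, …` are independent copies of `X`
    (Xs : ℕ → Ω → H) (hXs : ∀ n, 1 ≤ n → Measurable (Xs n))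
    (hlaw : ∀ n, 1 ≤ n → IdentDistrib (Xs n) X P P)
    (hindep : iIndepFun (fun n : ℕ => Xs (n + 1)) P)
    -- bounded initialization, independent of the data `Xs 2, Xs 3, …` used afterwards
    (Z₁ : Ω → H) (hZ₁ : Measurable Z₁) (hZ₁bdd : ∃ M : ℝ, ∀ᵐ ω ∂P, ‖Z₁ ω‖ ≤ M)
    (hZ₁indep : IndepFun Z₁ (fun ω (n : ℕ) => Xs (n + 2) ω) P)
    -- steps `γ_n = cγ n^{-α}`
    (cγ α : ℝ) (hcγ : 0 < cγ) (hα : 1 / 2 < α) (hα' : α < 1)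
    (δ : ℝ) (hδ : 0 < δ) :
    ∀ᵐ ω ∂P,
      (fun n : ℕ => ‖averagedIterate (sgdIterate (stepSize cγ α) Xs Z₁) n ω - m‖)
        =o[atTop] (fun n : ℕ => (Real.log n) ^ ((1 + δ) / 2) / Real.sqrt n) := by
  have := UniformSpace.secondCountable_of_separable H
  set μ := P.map X with hμ
  have : IsProbabilityMeasure μ := Measure.isProbabilityMeasure_map hX.aemeasurable
  have h₀ := ae_sub_ne_zero_of_notConcentratedAroundPoints hX hA2 m
  obtain ⟨h₁, h₂⟩ := integrable_inv_norm_pow_of_notConcentratedAroundPoints hX hA2 m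
  have hgrad : medianGrad μ m = 0 := by
    refine medianGrad_eq_zero h₀ h₁ h₂ fun h => ?_
    have hmap : ∀ y, ∫ x, (‖x - y‖ - ‖x‖) ∂μ = medianObjective P X y := fun y =>
      integral_map hX.aemeasurable (Measurable.aestronglyMeasurable (by fun_prop))
    rw [hmap, hmap]
    exact hm h
  obtain ⟨c, hc, hcoer⟩ := exists_medianHess_coercive h₀ h₁
    fun e _ => exists_orthogonal_not_ae_const hX hA1 m e
  have hstrong := exists_medianGrad_strongly_monotone h₀ h₁ h₂ hgrad hc hcoer
  have hmono : ∀ y, 0 ≤ inner ℝ (y - m) (medianGrad μ y) := fun y => by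
    have := inner_medianGrad_sub_nonneg (μ := μ) y m
    rwa [hgrad, sub_zero, real_inner_comm] at this
  -- Times are shifted to start at `0`: `z 0 = Z₁` is updated with `Xs 2` and step `γ_1`.
  set x : ℕ → Ω → H := fun n => Xs (n + 2) with hx
  set z : ℕ → Ω → H := fun n => sgdIterate (stepSize cγ α) Xs Z₁ (n + 1) with hz
  set γ : ℕ → ℝ := fun n => stepSize cγ α (n + 1) with hγ
  obtain ⟨ℱ, hF0, hF1, hFind⟩ := exists_filtration_of_iIndepFun (x := x) hZ₁
    (fun n => hXs (n + 2) (by omega))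
    (hindep.precomp (g := Nat.succ) Nat.succ_injective) hZ₁indep
  have hsgd : IsMedianSGD P μ ℱ γ x z :=
    { measurable_sample := fun n => hXs (n + 2) (by omega)
      indep := hFind
      law := fun n => (hlaw (n + 2) (by omega)).map_eq
      measurable_sample_succ := hF1
      measurable_init := hF0
      step := fun n ω => sgdIterate_add_two _ _ _ n ω
      bounded_init := hZ₁bdd }
  -- Above `1` for summability of `1 / b n`, below `1 + δ` to leave room for the little-o.
  set s : ℝ := 1 + δ / 2 with hs
  have hs1 : 1 < s := by linarith
  set b := logWeight s
  have hb := logWeight_pos s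
  have hbmono := monotone_logWeight (s := s) (by linarith)
  have hbs := summable_inv_logWeight hs1
  have hγ0 : ∀ n, 0 < γ n := stepSize_succ_pos hcγ
  obtain ⟨K₃, hK₃⟩ := exists_stepSize_mul_logWeight_le (s := s) hcγ hα (by linarith)
  have hR : ∀ n, γ n ^ 2 ≤ 4 * γ (n + 1) ^ 2 := fun n => by
    refine (stepSize_sq_le hcγ hα'.le n).trans (mul_le_mul_of_nonneg_right ?_ (sq_nonneg _))
    have h1 : 1 / ((n : ℝ) + 1) ≤ 1 := by
      rw [div_le_one (by positivity)]
      linarith [n.cast_nonneg (α := ℝ)]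
    have h2 : 0 ≤ 1 / ((n : ℝ) + 1) := by positivity
    nlinarith
  filter_upwards [hsgd.ae_rate hγ0 (summable_stepSize_sq hα) hmono hstrong hb hbmono hbs hR
      (fun d hd => eventually_stepSize_contraction hcγ (by linarith) hα' hd),
    hsgd.ae_norm_gradNoise_sq_le hb hbmono hbs] with ω ⟨⟨K₂, hK₂⟩, hsum⟩ ⟨K₁, hK₁⟩
  obtain ⟨K, hK⟩ := exists_norm_sum_le (Γ := medianHess μ m) (V := fun n => z n ω - m)
    (g := fun n => medianGrad μ (z n ω)) (D := fun n => unitDir (z n ω - x n ω))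
    (C := 3 * ∫ x, ‖m - x‖⁻¹ ^ 2 ∂μ)
    (fun n => medianHess_sum _ h₁ _) hc hcoer hγ0 (antitone_stepSize_succ hcγ (by linarith)) hb
    hbmono (fun k => by rw [hsgd.step, sub_right_comm])
    (mul_nonneg (by norm_num) (integral_nonneg fun x => by positivity))
    (fun k => by
      have := norm_medianGrad_sub_le (μ := μ) h₀ h₁ h₂ (z k ω)
      rwa [hgrad, sub_zero] at this) hK₁ hK₂ hsum hK₃
    (sum_sqrt_logWeight_le hcγ (by linarith) hα'.le (by linarith))
  refine IsBigO.trans_isLittleO (IsBigO.of_bound K ?_)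
    (isLittleO_sqrt_logWeight (s := s) (t := 1 + δ) (by linarith) (by linarith))
  filter_upwards [eventually_ge_atTop 1] with n hn
  rw [norm_norm, averagedIterate_sub_eq _ _ hn, norm_smul, norm_inv, Real.norm_natCast,
    Real.norm_of_nonneg (by positivity), inv_mul_eq_div, ← mul_div_assoc]
  gcongr
  exact hK n
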